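/- A prop is a strict symmetric monoidal category whose objects are the natural numbers, with tensor product of objects given by addition; a morphism of props is a strict symmetric monoidal functor that is the identity on objects. Let $k$ be a field. Let $\Sigma$ be the signature with generators $m\colon 2\to 1$, $i\colon 0\to 1$, $d\colon 1\to 2$, $e\colon 1\to 0$, and regard $k$ as a signature with one generator $1\to 1$ for each element of $k$. Write $F(-)$ for the free prop on a signature and $+$ for the coproduct of props. Put $$\widetilde{\mathrm{Circ}}_k = F(\Sigma)+F(k),\qquad \mathrm{SigFlow}_k = F(\Sigma)+F(\Sigma)+F(k).$$ The generators of $\mathrm{SigFlow}_k$ are called coduplication $\Delta^\dagger\colon 2\to 1$, codeletion $!^\dagger\colon 0\to 1$, duplication $\Delta\colon 1\to 2$, deletion $!\colon 1\to 0$ (the first copy of $\Sigma$), addition $+\colon 2\to 1$, zero $0\colon 0\to 1$, coaddition $+^\dagger\colon 1\to 2$, cozero $0^\dagger\colon 1\to 0$ (the second copy), and scalar multiplication $c\colon 1\to 1$ for each $c\in k$. Let $\mathrm{Circ}_k$ be the prop whose morphisms $m\to n$ are the isomorphism classes of finite directed graphs with edges labelled by elements of $k$ and with set of nodes $N$, together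 with a cospan of finite sets $\{1,\dots,m\}\to N\leftarrow\{1,\dots,n\}$; composition is by pushout and the tensor product is disjoint union. Let $P\colon\widetilde{\mathrm{Circ}}_k\to\mathrm{Circ}_k$ be the morphism of props that sends $m,i,d,e$ to the circuits with one node and no edges, and $Z\in k$ to the circuit with two nodes and a single edge, labelled $Z$, from the input node to the output node. Let $\mathrm{FinRel}_k$ be the prop whose morphisms $m\to n$ are the linear relations from $k^m$ to $k^n$, i.e. the linear subspaces of $k^m\oplus k^n$, with tensor product given by direct sum. Let $\mathrm{LagRel}_k$ be the prop whose morphisms $m\to n$ are the Lagrangian (i.e. maximal isotropic) subspaces of $\overline{(k\oplus k)^m}\oplus(k\oplus k)^n$, where $(k\oplus k)^n$ carries the symplectic form $\omega\big((\phi,I),(\phi',I')\big)=\sum_j(\phi_jI'_j-\phi'_jI_j)$ and the bar means that the sign of the form is changed. The inclusion $\mathrm{LagRel}_k\hookrightarrow\mathrm{FinRel}_k$ is the strict symmetric monoidal functor that sends $n$ to $2n$ by reading $(k\oplus k)^n$ as $k^{2n}$ with coordinates $(\phi_1,I_1,\phi_2,I_2,\dots)$. Let $\blacksquare\colon\mathrm{Circ}_k\to\mathrm{LagRel}_k$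 be the black-boxing morphism of props. It sends a circuit to the relation between the potentials and currents at its inputs and at its outputs that consists of all values that extend to potentials on the nodes and currents on the edges obeying Ohm's law (the potential at the target of an edge minus that at its source equals the label times the current) and Kirchhoff's current law. In particular $$\begin{aligned} \blacksquare(m)&=\{(\phi_1,I_1,\phi_2,I_2,\phi_3,I_3):\phi_1=\phi_2=\phi_3,\ I_1+I_2=I_3\}, & \blacksquare(i)&=\{(\phi_2,I_2):I_2=0\},\\ \blacksquare(d)&=\{(\phi_1,I_1,\phi_2,I_2,\phi_3,I_3):\phi_1=\phi_2=\phi_3,\ I_1=I_2+I_3\}, & \blacksquare(e)&=\{(\phi_1,I_1):I_1=0\},\\ \blacksquare(Z)&=\{(\phi_1,I_1,\phi_2,I_2):\phi_2-\phi_1=ZI_1,\ I_1=I_2\}. \end{aligned}$$ Let $\square\colon\mathrm{SigFlow}_k\to\mathrm{FinRel}_k$ be the morphism of props that sends $\Delta,!,+,0,c$ to the graphs of the linear maps $x\mapsto(x,x)$, $k\to\{0\}$, $(x,y)\mapsto x+y$, $\{0\}\to k$, $x\mapsto cx$ respectively, and $\Delta^\dagger,!^\dagger,+^\dagger,0^\dagger$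 to the converses of the graphs for $\Delta,!,+,0$. **Theorem.** For any field $k$ there is a strict symmetric monoidal functor $T\colon\widetilde{\mathrm{Circ}}_k\to\mathrm{SigFlow}_k$, sending the object $1$ to the object $2$, such that the square of strict symmetric monoidal functors $$\begin{array}{ccc} \widetilde{\mathrm{Circ}}_k & \xrightarrow{\ P\ }\ \mathrm{Circ}_k\ \xrightarrow{\ \blacksquare\ } & \mathrm{LagRel}_k\\ {\scriptstyle T}\downarrow & & \downarrow\\ \mathrm{SigFlow}_k & \xrightarrow{\qquad\square\qquad} & \mathrm{FinRel}_k \end{array}$$ commutes: $\square\circ T$ equals the composite of $P$, $\blacksquare$ and the inclusion $\mathrm{LagRel}_k\hookrightarrow\mathrm{FinRel}_k$. -/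

import Mathlib

universe u v w

namespace CircuitProps


section Props

/-- Transport of a morphism along equalities of its source and its target. -/
def castHom {H : ℕ → ℕ → Type u} {m m' n n' : ℕ} (hm : m = m') (hn : n = n') (f : H m n) :
    H m' n' :=
  hn ▸ hm ▸ f

/-- A prop: a strict symmetric monoidal category whose objects are the natural numbers, with
tensor product of objects given by addition.  Composition is written in diagrammatic order. -/
structure PROP where
  Hom : ℕ → ℕ → Type u
  id : ∀ n, Hom n n
  comp : ∀ {l m n}, Hom l m → Hom m n → Hom l n
  tensor : ∀ {m n m' n'}, Hom m n → Hom m' n' → Hom (m + m') (n + n')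
  braid : ∀ m n, Hom (m + n) (n + m)
  id_comp : ∀ {m n} (f : Hom m n), comp (id m) f = f
  comp_id : ∀ {m n} (f : Hom m n), comp f (id n) = f
  assoc : ∀ {l m n p} (f : Hom l m) (g : Hom m n) (h : Hom n p),
    comp (comp f g) h = comp f (comp g h)
  tensor_id : ∀ m n, tensor (id m) (id n) = id (m + n)
  tensor_comp : ∀ {l m n l' m' n'} (f : Hom l m) (g : Hom m n) (f' : Hom l' m') (g' : Hom m' n'),
    tensor (comp f g) (comp f' g') = comp (tensor f f') (tensor g g')
  tensor_assoc : ∀ {m n m' n' m'' n''} (f : Hom m n) (g : Hom m' n') (h : Hom m'' n''),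
    castHom (add_assoc m m' m'') (add_assoc n n' n'') (tensor (tensor f g) h) =
      tensor f (tensor g h)
  id_zero_tensor : ∀ {m n} (f : Hom m n),
    castHom (zero_add m) (zero_add n) (tensor (id 0) f) = f
  tensor_id_zero : ∀ {m n} (f : Hom m n),
    castHom (add_zero m) (add_zero n) (tensor f (id 0)) = f
  braid_natural : ∀ {m n m' n'} (f : Hom m n) (g : Hom m' n'),
    comp (tensor f g) (braid n n') = comp (braid m m') (tensor g f)
  braid_symm : ∀ m n, comp (braid m n) (braid n m) = id (m + n)
  braid_zero : ∀ n, castHom (zero_add n) (add_zero n) (braid 0 n) = id n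
  hexagon : ∀ m n p,
    castHom (add_assoc m n p).symm (add_assoc n p m) (braid m (n + p)) =
      comp (castHom rfl (add_assoc n m p) (tensor (braid m n) (id p)))
        (tensor (id n) (braid m p))

/-- A strict symmetric monoidal functor between props. -/
structure StrictFunctor (P : PROP.{u}) (Q : PROP.{v}) where
  obj : ℕ → ℕ
  map : ∀ {m n}, P.Hom m n → Q.Hom (obj m) (obj n)
  obj_zero : obj 0 = 0
  obj_add : ∀ m n, obj (m + n) = obj m + obj n
  map_id : ∀ n, map (P.id n) = Q.id (obj n)
  map_comp : ∀ {l m n} (f : P.Hom l m) (g : P.Hom m n),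
    map (P.comp f g) = Q.comp (map f) (map g)
  map_tensor : ∀ {m n m' n'} (f : P.Hom m n) (g : P.Hom m' n'),
    castHom (obj_add m m') (obj_add n n') (map (P.tensor f g)) = Q.tensor (map f) (map g)
  map_braid : ∀ m n,
    castHom (obj_add m n) (obj_add n m) (map (P.braid m n)) = Q.braid (obj m) (obj n)

/-- A morphism of props: a strict symmetric monoidal functor that is the identity on objects. -/
structure PropHom (P : PROP.{u}) (Q : PROP.{v}) where
  map : ∀ {m n}, P.Hom m n → Q.Hom m n
  map_id : ∀ n, map (P.id n) = Q.id n
  map_comp : ∀ {l m n} (f : P.Hom l m) (g : P.Hom m n),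
    map (P.comp f g) = Q.comp (map f) (map g)
  map_tensor : ∀ {m n m' n'} (f : P.Hom m n) (g : P.Hom m' n'),
    map (P.tensor f g) = Q.tensor (map f) (map g)
  map_braid : ∀ m n, map (P.braid m n) = Q.braid m n

/-- A morphism of props, seen as a strict symmetric monoidal functor. -/
def PropHom.toStrictFunctor {P : PROP.{u}} {Q : PROP.{v}} (F : PropHom P Q) :
    StrictFunctor P Q where
  obj n := n
  map f := F.map f
  obj_zero := rfl
  obj_add _ _ := rfl
  map_id := F.map_id
  map_comp := F.map_comp
  map_tensor := F.map_tensor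
  map_braid := F.map_braid

theorem castHom_castHom {H : ℕ → ℕ → Type u} {m m' m'' n n' n'' : ℕ} (hm : m = m') (hn : n = n')
    (hm' : m' = m'') (hn' : n' = n'') (f : H m n) :
    castHom hm' hn' (castHom hm hn f) = castHom (hm.trans hm') (hn.trans hn') f := by
  subst hm hn hm' hn'; rfl

theorem StrictFunctor.map_castHom {P : PROP.{u}} {Q : PROP.{v}} (F : StrictFunctor P Q)
    {m m' n n' : ℕ} (hm : m = m') (hn : n = n') (f : P.Hom m n) :
    F.map (castHom hm hn f) = castHom (congrArg F.obj hm) (congrArg F.obj hn) (F.map f) := by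
  subst hm hn; rfl

/-- Composition of strict symmetric monoidal functors: first `F`, then `G`. -/
def StrictFunctor.comp {P : PROP.{u}} {Q : PROP.{v}} {R : PROP.{w}} (F : StrictFunctor P Q)
    (G : StrictFunctor Q R) : StrictFunctor P R where
  obj n := G.obj (F.obj n)
  map f := G.map (F.map f)
  obj_zero := by rw [F.obj_zero, G.obj_zero]
  obj_add m n := by rw [F.obj_add, G.obj_add]
  map_id n := by rw [F.map_id, G.map_id]
  map_comp f g := by rw [F.map_comp, G.map_comp]
  map_tensor f g := by
    rw [← G.map_tensor, ← F.map_tensor, G.map_castHom, castHom_castHom]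
  map_braid m n := by
    rw [← G.map_braid, ← F.map_braid, G.map_castHom, castHom_castHom]

end Props

section Free

/-- A signature: a family of sets of generators `m ⟶ n`. -/
abbrev Signature := ℕ → ℕ → Type u

/-- The disjoint union of two signatures. -/
def Signature.sum (S : Signature.{u}) (S' : Signature.{v}) : Signature.{max u v} :=
  fun m n => S m n ⊕ S' m n

/-- Formal expressions in the generators of a signature and the operations of a prop. -/
inductive Term (S : Signature.{u}) : ℕ → ℕ → Type u
  | gen {m n : ℕ} (s : S m n) : Term S m n
  | id (n : ℕ) : Term S n n
  | comp {l m n : ℕ} (f : Term S l m) (g : Term S m n) : Term S l n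
  | tensor {m n m' n' : ℕ} (f : Term S m n) (g : Term S m' n') : Term S (m + m') (n + n')
  | braid (m n : ℕ) : Term S (m + n) (n + m)

/-- The smallest congruence on formal expressions for which the laws of a prop hold. -/
inductive Term.Rel {S : Signature.{u}} : ∀ {m n : ℕ}, Term S m n → Term S m n → Prop
  | refl {m n} (f : Term S m n) : Rel f f
  | symm {m n} {f g : Term S m n} : Rel f g → Rel g f
  | trans {m n} {f g h : Term S m n} : Rel f g → Rel g h → Rel f h
  | comp_congr {l m n} {f f' : Term S l m} {g g' : Term S m n} :
      Rel f f' → Rel g g' → Rel (f.comp g) (f'.comp g')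
  | tensor_congr {m n m' n'} {f f' : Term S m n} {g g' : Term S m' n'} :
      Rel f f' → Rel g g' → Rel (f.tensor g) (f'.tensor g')
  | id_comp {m n} (f : Term S m n) : Rel ((id m).comp f) f
  | comp_id {m n} (f : Term S m n) : Rel (f.comp (id n)) f
  | assoc {l m n p} (f : Term S l m) (g : Term S m n) (h : Term S n p) :
      Rel ((f.comp g).comp h) (f.comp (g.comp h))
  | tensor_id (m n) : Rel ((id m).tensor (id n)) (id (m + n))
  | tensor_comp {l m n l' m' n'} (f : Term S l m) (g : Term S m n)
      (f' : Term S l' m') (g' : Term S m' n') :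
      Rel ((f.comp g).tensor (f'.comp g')) ((f.tensor f').comp (g.tensor g'))
  | tensor_assoc {m n m' n' m'' n''} (f : Term S m n) (g : Term S m' n') (h : Term S m'' n'') :
      Rel (castHom (add_assoc m m' m'') (add_assoc n n' n'') ((f.tensor g).tensor h))
        (f.tensor (g.tensor h))
  | id_zero_tensor {m n} (f : Term S m n) :
      Rel (castHom (zero_add m) (zero_add n) ((id 0).tensor f)) f
  | tensor_id_zero {m n} (f : Term S m n) :
      Rel (castHom (add_zero m) (add_zero n) (f.tensor (id 0))) f
  | braid_natural {m n m' n'} (f : Term S m n) (g : Term S m' n') :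
      Rel ((f.tensor g).comp (braid n n')) ((braid m m').comp (g.tensor f))
  | braid_symm (m n) : Rel ((braid m n).comp (braid n m)) (id (m + n))
  | braid_zero (n) : Rel (castHom (zero_add n) (add_zero n) (braid 0 n)) (id n)
  | hexagon (m n p) :
      Rel (castHom (add_assoc m n p).symm (add_assoc n p m) (braid m (n + p)))
        ((castHom rfl (add_assoc n m p) ((braid m n).tensor (id p))).comp
          ((id n).tensor (braid m p)))

theorem mk_castHom {S : Signature.{u}} {m m' n n' : ℕ} (hm : m = m') (hn : n = n')
    (f : Term S m n) :
    Quot.mk Term.Rel (castHom hm hn f) =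
      castHom (H := fun m n => Quot (@Term.Rel S m n)) hm hn (Quot.mk Term.Rel f) := by
  subst hm hn; rfl

/-- The free prop on a signature. -/
def FreeProp (S : Signature.{u}) : PROP.{u} where
  Hom m n := Quot (@Term.Rel S m n)
  id n := Quot.mk _ (Term.id n)
  comp := Quot.map₂ Term.comp (fun _ _ _ h => .comp_congr (.refl _) h)
    (fun _ _ _ h => .comp_congr h (.refl _))
  tensor := Quot.map₂ Term.tensor (fun _ _ _ h => .tensor_congr (.refl _) h)
    (fun _ _ _ h => .tensor_congr h (.refl _))
  braid m n := Quot.mk _ (Term.braid m n)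
  id_comp := by rintro _ _ ⟨f⟩; exact Quot.sound (.id_comp f)
  comp_id := by rintro _ _ ⟨f⟩; exact Quot.sound (.comp_id f)
  assoc := by rintro _ _ _ _ ⟨f⟩ ⟨g⟩ ⟨h⟩; exact Quot.sound (.assoc f g h)
  tensor_id m n := Quot.sound (.tensor_id m n)
  tensor_comp := by
    rintro _ _ _ _ _ _ ⟨f⟩ ⟨g⟩ ⟨f'⟩ ⟨g'⟩; exact Quot.sound (.tensor_comp f g f' g')
  tensor_assoc := by
    rintro _ _ _ _ _ _ ⟨f⟩ ⟨g⟩ ⟨h⟩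
    exact (mk_castHom _ _ _).symm.trans (Quot.sound (.tensor_assoc f g h))
  id_zero_tensor := by
    rintro _ _ ⟨f⟩
    exact (mk_castHom _ _ _).symm.trans (Quot.sound (.id_zero_tensor f))
  tensor_id_zero := by
    rintro _ _ ⟨f⟩
    exact (mk_castHom _ _ _).symm.trans (Quot.sound (.tensor_id_zero f))
  braid_natural := by rintro _ _ _ _ ⟨f⟩ ⟨g⟩; exact Quot.sound (.braid_natural f g)
  braid_symm m n := Quot.sound (.braid_symm m n)
  braid_zero n := (mk_castHom _ _ _).symm.trans (Quot.sound (.braid_zero n))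
  hexagon m n p := by
    refine (mk_castHom _ _ _).symm.trans ((Quot.sound (.hexagon m n p)).trans ?_)
    exact congrArg (fun t => Quot.map₂ Term.comp (fun _ _ _ h => .comp_congr (.refl _) h)
      (fun _ _ _ h => .comp_congr h (.refl _)) t
        (Quot.mk _ ((Term.id n).tensor (Term.braid m p)))) (mk_castHom _ _ _)

/-- A generator, as a morphism of the free prop. -/
def FreeProp.of {S : Signature.{u}} {m n : ℕ} (s : S m n) : (FreeProp S).Hom m n :=
  Quot.mk _ (Term.gen s)

/-- The value of a formal expression in a prop, given the values of the generators. -/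
def Term.eval {S : Signature.{u}} (Q : PROP.{v}) (φ : ∀ {m n}, S m n → Q.Hom m n) :
    ∀ {m n}, Term S m n → Q.Hom m n
  | _, _, .gen s => φ s
  | _, _, .id n => Q.id n
  | _, _, .comp f g => Q.comp (f.eval Q φ) (g.eval Q φ)
  | _, _, .tensor f g => Q.tensor (f.eval Q φ) (g.eval Q φ)
  | _, _, .braid m n => Q.braid m n

theorem Term.eval_castHom {S : Signature.{u}} (Q : PROP.{v}) (φ : ∀ {m n}, S m n → Q.Hom m n)
    {m m' n n' : ℕ} (hm : m = m') (hn : n = n') (f : Term S m n) :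
    (castHom hm hn f).eval Q φ = castHom hm hn (f.eval Q φ) := by
  subst hm hn; rfl

theorem Term.Rel.eval_eq {S : Signature.{u}} (Q : PROP.{v}) (φ : ∀ {m n}, S m n → Q.Hom m n)
    {m n : ℕ} {f g : Term S m n} (h : Term.Rel f g) : f.eval Q φ = g.eval Q φ := by
  induction h with
  | refl => rfl
  | symm _ ih => exact ih.symm
  | trans _ _ ih ih' => exact ih.trans ih'
  | comp_congr _ _ ih ih' => simp only [Term.eval, ih, ih']
  | tensor_congr _ _ ih ih' => simp only [Term.eval, ih, ih']
  | id_comp f => exact Q.id_comp _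
  | comp_id f => exact Q.comp_id _
  | assoc f g h => exact Q.assoc _ _ _
  | tensor_id m n => exact Q.tensor_id m n
  | tensor_comp f g f' g' => exact Q.tensor_comp _ _ _ _
  | tensor_assoc f g h => rw [Term.eval_castHom]; exact Q.tensor_assoc _ _ _
  | id_zero_tensor f => rw [Term.eval_castHom]; exact Q.id_zero_tensor _
  | tensor_id_zero f => rw [Term.eval_castHom]; exact Q.tensor_id_zero _
  | braid_natural f g => exact Q.braid_natural _ _
  | braid_symm m n => exact Q.braid_symm m n
  | braid_zero n => rw [Term.eval_castHom]; exact Q.braid_zero n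
  | hexagon m n p =>
    rw [Term.eval_castHom]
    refine (Q.hexagon m n p).trans ?_
    simp only [Term.eval, Term.eval_castHom]

/-- The morphism of props out of a free prop with given values on the generators. -/
def FreeProp.lift {S : Signature.{u}} (Q : PROP.{v}) (φ : ∀ {m n}, S m n → Q.Hom m n) :
    PropHom (FreeProp S) Q where
  map := Quot.lift (Term.eval Q φ) fun _ _ h => h.eval_eq Q φ
  map_id _ := rfl
  map_comp := by rintro _ _ _ ⟨f⟩ ⟨g⟩; rfl
  map_tensor := by rintro _ _ _ _ ⟨f⟩ ⟨g⟩; rfl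
  map_braid _ _ := rfl

/-- The signature with generators `m : 2 ⟶ 1`, `i : 0 ⟶ 1`, `d : 1 ⟶ 2` and `e : 1 ⟶ 0`. -/
inductive FrobSig : ℕ → ℕ → Type
  | m : FrobSig 2 1
  | i : FrobSig 0 1
  | d : FrobSig 1 2
  | e : FrobSig 1 0

/-- The signature with one generator `1 ⟶ 1` for each element of `L`. -/
inductive LabelSig (L : Type u) : ℕ → ℕ → Type u
  | label (l : L) : LabelSig L 1 1

/-- The prop of circuit diagrams, free on `m`, `i`, `d`, `e` and the labels: it is the coproduct
of the free props on `FrobSig` and on `LabelSig L`. -/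
def FreeCirc (L : Type u) : PROP.{u} := FreeProp (Signature.sum FrobSig (LabelSig L))

end Free

section LinearRelations

theorem funext_sum {V : Type u} {m n : ℕ} {x y : Fin (m + n) → V}
    (h : ∀ i, x (Fin.castAdd n i) = y (Fin.castAdd n i))
    (h' : ∀ i, x (Fin.natAdd m i) = y (Fin.natAdd m i)) : x = y :=
  funext fun i => Fin.addCases (motive := fun i => x i = y i) h h' i

variable (k : Type u) [Field k] (V : Type u) [AddCommGroup V] [Module k V]

/-- A linear relation from `V ^ m` to `V ^ n`. -/
abbrev LinearRelation (m n : ℕ) : Type u := Submodule k ((Fin m → V) × (Fin n → V))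

variable {k V}

namespace LinearRelation

variable (k V) in
/-- The identity relation. -/
def id (n : ℕ) : LinearRelation k V n n where
  carrier := {p | p.1 = p.2}
  add_mem' {p q} hp hq := by
    simp only [Set.mem_ofPred_eq] at hp hq ⊢
    simp [hp, hq]
  zero_mem' := rfl
  smul_mem' c p hp := by
    simp only [Set.mem_ofPred_eq] at hp ⊢
    simp [hp]

/-- The composite of two relations: first `L`, then `M`. -/
def comp {l m n : ℕ} (L : LinearRelation k V l m) (M : LinearRelation k V m n) :
    LinearRelation k V l n where
  carrier := {p | ∃ y, (p.1, y) ∈ L ∧ (y, p.2) ∈ M}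
  add_mem' := by
    rintro p q ⟨y, h, h'⟩ ⟨z, g, g'⟩
    exact ⟨y + z, L.add_mem h g, M.add_mem h' g'⟩
  zero_mem' := ⟨0, L.zero_mem, M.zero_mem⟩
  smul_mem' := by
    rintro c p ⟨y, h, h'⟩
    exact ⟨c • y, L.smul_mem c h, M.smul_mem c h'⟩

/-- The direct sum of two relations. -/
def tensor {m n m' n' : ℕ} (L : LinearRelation k V m n) (M : LinearRelation k V m' n') :
    LinearRelation k V (m + m') (n + n') where
  carrier := {p | ((fun i => p.1 (Fin.castAdd m' i)), fun i => p.2 (Fin.castAdd n' i)) ∈ L ∧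
    ((fun i => p.1 (Fin.natAdd m i)), fun i => p.2 (Fin.natAdd n i)) ∈ M}
  add_mem' {_ _} h h' := ⟨L.add_mem h.1 h'.1, M.add_mem h.2 h'.2⟩
  zero_mem' := ⟨L.zero_mem, M.zero_mem⟩
  smul_mem' c _ h := ⟨L.smul_mem c h.1, M.smul_mem c h.2⟩

variable (k V) in
/-- The braiding: the graph of the map that exchanges `V ^ m` and `V ^ n`. -/
def braid (m n : ℕ) : LinearRelation k V (m + n) (n + m) where
  carrier := {p | (∀ i : Fin m, p.2 (Fin.natAdd n i) = p.1 (Fin.castAdd n i)) ∧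
    ∀ i : Fin n, p.2 (Fin.castAdd m i) = p.1 (Fin.natAdd m i)}
  add_mem' {_ _} h h' := ⟨fun i => by simp [h.1, h'.1], fun i => by simp [h.2, h'.2]⟩
  zero_mem' := ⟨fun _ => rfl, fun _ => rfl⟩
  smul_mem' c _ h := ⟨fun i => by simp [h.1], fun i => by simp [h.2]⟩

theorem mem_id {n : ℕ} {x y : Fin n → V} : (x, y) ∈ id k V n ↔ x = y := Iff.rfl

theorem mem_comp {l m n : ℕ} {L : LinearRelation k V l m} {M : LinearRelation k V m n}
    {x : Fin l → V} {z : Fin n → V} : (x, z) ∈ comp L M ↔ ∃ y, (x, y) ∈ L ∧ (y, z) ∈ M := Iff.rfl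

theorem mem_tensor {m n m' n' : ℕ} {L : LinearRelation k V m n} {M : LinearRelation k V m' n'}
    {x : Fin (m + m') → V} {y : Fin (n + n') → V} : (x, y) ∈ tensor L M ↔
    ((fun i => x (Fin.castAdd m' i)), fun i => y (Fin.castAdd n' i)) ∈ L ∧
    ((fun i => x (Fin.natAdd m i)), fun i => y (Fin.natAdd n i)) ∈ M := Iff.rfl

theorem mem_braid {m n : ℕ} {x : Fin (m + n) → V} {y : Fin (n + m) → V} :
    (x, y) ∈ braid k V m n ↔ (∀ i : Fin m, y (Fin.natAdd n i) = x (Fin.castAdd n i)) ∧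
    ∀ i : Fin n, y (Fin.castAdd m i) = x (Fin.natAdd m i) := Iff.rfl

theorem mem_castHom {m m' n n' : ℕ} (hm : m = m') (hn : n = n') (L : LinearRelation k V m n)
    {x : Fin m' → V} {y : Fin n' → V} :
    (x, y) ∈ (castHom (H := LinearRelation k V) hm hn L) ↔
      ((fun i => x (Fin.cast hm i)), fun i => y (Fin.cast hn i)) ∈ L := by
  subst hm hn; rfl

theorem ext' {m n : ℕ} {L M : LinearRelation k V m n}
    (h : ∀ x y, (x, y) ∈ L ↔ (x, y) ∈ M) : L = M :=
  Submodule.ext fun p => h p.1 p.2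

theorem forall_fin_add {m n : ℕ} {p : Fin (m + n) → Prop} :
    (∀ i, p i) ↔ (∀ i, p (Fin.castAdd n i)) ∧ ∀ i, p (Fin.natAdd m i) :=
  ⟨fun h => ⟨fun _ => h _, fun _ => h _⟩, fun h i => Fin.addCases h.1 h.2 i⟩

theorem cast_castAdd_castAdd {m n p : ℕ} (i : Fin m) :
    Fin.cast (add_assoc m n p) (Fin.castAdd p (Fin.castAdd n i)) = Fin.castAdd (n + p) i :=
  Fin.ext rfl

theorem cast_castAdd_natAdd {m n p : ℕ} (i : Fin n) :
    Fin.cast (add_assoc m n p) (Fin.castAdd p (Fin.natAdd m i)) =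
      Fin.natAdd m (Fin.castAdd p i) :=
  Fin.ext rfl

theorem cast_natAdd {m n p : ℕ} (i : Fin p) :
    Fin.cast (add_assoc m n p) (Fin.natAdd (m + n) i) = Fin.natAdd m (Fin.natAdd n i) :=
  Fin.ext (add_assoc m n i)

theorem cast_symm_castAdd {m n p : ℕ} {i : Fin m} :
    Fin.cast (add_assoc m n p).symm (Fin.castAdd (n + p) i) = Fin.castAdd p (Fin.castAdd n i) :=
  Fin.ext rfl

theorem cast_symm_natAdd_castAdd {m n p : ℕ} {i : Fin n} :
    Fin.cast (add_assoc m n p).symm (Fin.natAdd m (Fin.castAdd p i)) =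
      Fin.castAdd p (Fin.natAdd m i) :=
  Fin.ext rfl

theorem cast_symm_natAdd_natAdd {m n p : ℕ} {i : Fin p} :
    Fin.cast (add_assoc m n p).symm (Fin.natAdd m (Fin.natAdd n i)) = Fin.natAdd (m + n) i :=
  Fin.ext (add_assoc m n i).symm

theorem cast_zero_natAdd {n : ℕ} (i : Fin n) :
    Fin.cast (zero_add n) (Fin.natAdd 0 i) = i :=
  Fin.ext (zero_add _)

theorem cast_zero_castAdd {n : ℕ} (i : Fin n) :
    Fin.cast (add_zero n) (Fin.castAdd 0 i) = i := rfl

theorem cast_refl {n : ℕ} (i : Fin n) (h : n = n) : Fin.cast h i = i := rfl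

end LinearRelation

open LinearRelation in
variable (k V) in
/-- The prop of linear relations between the powers of `V`. -/
def LinRel : PROP.{u} where
  Hom := LinearRelation k V
  id := LinearRelation.id k V
  comp := LinearRelation.comp
  tensor := LinearRelation.tensor
  braid := LinearRelation.braid k V
  id_comp f := ext' fun x y => by simp [mem_comp, mem_id]
  comp_id f := ext' fun x y => by simp [mem_comp, mem_id]
  assoc f g h := ext' fun x y => by
    simp only [mem_comp]
    constructor
    · rintro ⟨z, ⟨w, h1, h2⟩, h3⟩; exact ⟨w, h1, z, h2, h3⟩
    · rintro ⟨w, h1, z, h2, h3⟩; exact ⟨z, ⟨w, h1, h2⟩, h3⟩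
  tensor_id m n := ext' fun x y => by
    simp only [mem_tensor, mem_id, funext_iff, forall_fin_add (m := m)]
  tensor_comp f g f' g' := ext' fun x y => by
    simp only [mem_tensor, mem_comp]
    constructor
    · rintro ⟨⟨u, h1, h2⟩, ⟨v, h3, h4⟩⟩
      exact ⟨Fin.append u v, by simpa using ⟨h1, h3⟩, by simpa using ⟨h2, h4⟩⟩
    · rintro ⟨w, ⟨h1, h2⟩, h3, h4⟩
      exact ⟨⟨_, h1, h3⟩, _, h2, h4⟩
  tensor_assoc f g h := ext' fun x y => by
    rw [mem_castHom]
    simp only [mem_tensor, cast_castAdd_castAdd, cast_castAdd_natAdd, cast_natAdd, and_assoc]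
  id_zero_tensor f := ext' fun x y => by
    rw [mem_castHom]
    simp only [mem_tensor, mem_id, cast_zero_natAdd]
    exact and_iff_right (Subsingleton.elim _ _)
  tensor_id_zero f := ext' fun x y => by
    rw [mem_castHom]
    simp only [mem_tensor, mem_id, cast_zero_castAdd]
    exact and_iff_left (Subsingleton.elim _ _)
  braid_natural {m n m' n'} f g := ext' fun x y => by
    simp only [mem_comp, mem_tensor, mem_braid]
    constructor
    · rintro ⟨z, ⟨h1, h2⟩, h3, h4⟩
      refine ⟨Fin.append (fun i => x (Fin.natAdd m i)) (fun i => x (Fin.castAdd m' i)), ?_, ?_⟩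
      · simp
      · simpa [h3, h4] using ⟨h2, h1⟩
    · rintro ⟨z, ⟨h1, h2⟩, h3, h4⟩
      refine ⟨Fin.append (fun i => y (Fin.natAdd n' i)) (fun i => y (Fin.castAdd n i)), ?_, ?_⟩
      · simp only [h1, h2] at h3 h4
        simpa using ⟨h4, h3⟩
      · simp
  braid_symm m n := ext' fun x y => by
    simp only [mem_comp, mem_braid, mem_id]
    constructor
    · rintro ⟨z, ⟨h1, h2⟩, h3, h4⟩
      exact funext_sum (fun i => by rw [h4, h1]) (fun i => by rw [h3, h2])
    · rintro rfl
      exact ⟨Fin.append (fun i => x (Fin.natAdd m i)) (fun i => x (Fin.castAdd n i)), by simp,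
        by simp⟩
  braid_zero n := ext' fun x y => by
    rw [mem_castHom]
    simp only [mem_braid, mem_id, cast_zero_natAdd, cast_zero_castAdd]
    constructor
    · rintro ⟨-, h⟩; exact funext fun i => (h i).symm
    · rintro rfl; exact ⟨fun i => i.elim0, fun _ => rfl⟩
  hexagon m n p := ext' fun x y => by
    rw [mem_castHom]
    simp only [mem_comp, mem_castHom, mem_tensor, mem_braid, mem_id, forall_fin_add (m := n),
      cast_symm_castAdd, cast_symm_natAdd_castAdd, cast_symm_natAdd_natAdd, cast_castAdd_castAdd,
      cast_castAdd_natAdd, cast_natAdd, cast_refl, funext_iff]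
    constructor
    · rintro ⟨h1, h2, h3⟩
      refine ⟨Fin.append (fun i => x (Fin.castAdd p (Fin.natAdd m i))) (Fin.append
        (fun i => x (Fin.castAdd p (Fin.castAdd n i))) (fun i => x (Fin.natAdd (m + n) i))),
        ⟨⟨?_, ?_⟩, ?_⟩, ?_, ?_, ?_⟩ <;> intro i <;> simp [h1, h2, h3]
    · rintro ⟨z, ⟨⟨h1, h2⟩, h3⟩, h4, h5, h6⟩
      exact ⟨fun i => by rw [h5, h1], fun i => by rw [← h4, h2], fun i => by rw [h6, h3]⟩

variable (k) in
/-- The prop of linear relations between the spaces `k ^ n`. -/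
def FinRel : PROP.{u} := LinRel k k

end LinearRelations

section LagrangianRelations

variable {k : Type u} [Field k]

/-- A subspace is isotropic for a form if the form vanishes on it. -/
def IsIsotropic {W : Type u} [AddCommGroup W] [Module k W] (ω : LinearMap.BilinForm k W)
    (L : Submodule k W) : Prop :=
  ∀ v ∈ L, ∀ w ∈ L, ω v w = 0

/-- A subspace is Lagrangian if it is isotropic and not properly contained in any other isotropic
subspace. -/
def IsLagrangian {W : Type u} [AddCommGroup W] [Module k W] (ω : LinearMap.BilinForm k W)
    (L : Submodule k W) : Prop :=
  IsIsotropic ω L ∧ ∀ M, IsIsotropic ω M → L ≤ M → M = L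

theorem isLagrangian_iff {W : Type u} [AddCommGroup W] [Module k W]
    {ω : LinearMap.BilinForm k W} (hω : ∀ v, ω v v = 0) (L : Submodule k W) :
    IsLagrangian ω L ↔ ∀ v, v ∈ L ↔ ∀ w ∈ L, ω v w = 0 := by
  have hanti : ∀ v w, ω v w = - ω w v := fun v w => by
    have := hω (v + w)
    simp only [map_add, LinearMap.add_apply, hω, zero_add, add_zero] at this
    exact eq_neg_of_add_eq_zero_right this
  constructor
  · rintro ⟨h, h'⟩ v
    refine ⟨fun hv w hw => h v hv w hw, fun hv => ?_⟩
    have : L ⊔ Submodule.span k {v} = L := by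
      refine h' _ ?_ le_sup_left
      intro a ha b hb
      obtain ⟨a, haL, c, hc, rfl⟩ := Submodule.mem_sup.1 ha
      obtain ⟨b, hbL, d, hd, rfl⟩ := Submodule.mem_sup.1 hb
      obtain ⟨c, rfl⟩ := Submodule.mem_span_singleton.1 hc
      obtain ⟨d, rfl⟩ := Submodule.mem_span_singleton.1 hd
      simp [h a haL b hbL, hω, hv b hbL, hanti a v, hv a haL]
    rw [← this]
    exact Submodule.mem_sup_right (Submodule.mem_span_singleton_self v)
  · intro h
    refine ⟨fun v hv w hw => (h v).1 hv w hw, fun M hM hLM => le_antisymm (fun v hv => ?_) hLM⟩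
    exact (h v).2 fun w hw => hM v hv w (hLM hw)

variable (k) in
/-- The standard symplectic form on `(k ⊕ k) ^ n`, the direct sum of `n` copies of the form
`((φ, I), (φ', I')) ↦ φ I' - φ' I`. -/
def sympForm (n : ℕ) : LinearMap.BilinForm k (Fin n → k × k) :=
  LinearMap.mk₂ k (fun x y => ∑ j, ((x j).1 * (y j).2 - (y j).1 * (x j).2))
    (fun x x' y => by
      rw [← Finset.sum_add_distrib]; exact Finset.sum_congr rfl fun j _ => by simp; ring)
    (fun c x y => by
      rw [Finset.smul_sum]; exact Finset.sum_congr rfl fun j _ => by simp; ring)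
    (fun x y y' => by
      rw [← Finset.sum_add_distrib]; exact Finset.sum_congr rfl fun j _ => by simp; ring)
    (fun c x y => by
      rw [Finset.smul_sum]; exact Finset.sum_congr rfl fun j _ => by simp; ring)

variable (k) in
/-- The symplectic form on the direct sum of the conjugate of `(k ⊕ k) ^ m` and `(k ⊕ k) ^ n`. -/
def relForm (m n : ℕ) : LinearMap.BilinForm k ((Fin m → k × k) × (Fin n → k × k)) :=
  -(sympForm k m).compl₁₂ (LinearMap.fst k _ _) (LinearMap.fst k _ _) +
    (sympForm k n).compl₁₂ (LinearMap.snd k _ _) (LinearMap.snd k _ _)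

/-- A linear Lagrangian relation from `(k ⊕ k) ^ m` to `(k ⊕ k) ^ n`. -/
def IsLagrangianRelation {m n : ℕ} (L : LinearRelation k (k × k) m n) : Prop :=
  IsLagrangian (relForm k m n) L

theorem sympForm_apply {n : ℕ} (x y : Fin n → k × k) :
    sympForm k n x y = ∑ j, ((x j).1 * (y j).2 - (y j).1 * (x j).2) := rfl

theorem relForm_apply {m n : ℕ} (p q : (Fin m → k × k) × (Fin n → k × k)) :
    relForm k m n p q = -sympForm k m p.1 q.1 + sympForm k n p.2 q.2 := rfl

theorem sympForm_self {n : ℕ} (x : Fin n → k × k) : sympForm k n x x = 0 := by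
  simp [sympForm_apply]

theorem sympForm_anti {n : ℕ} (x y : Fin n → k × k) :
    sympForm k n x y = -sympForm k n y x := by
  simp only [sympForm_apply, ← Finset.sum_neg_distrib, neg_sub]

theorem sympForm_single_left {n : ℕ} (j : Fin n) (v : k × k) (y : Fin n → k × k) :
    sympForm k n (Pi.single j v) y = v.1 * (y j).2 - (y j).1 * v.2 := by
  rw [sympForm_apply, Finset.sum_eq_single j]
  · simp
  · intro i _ hi; simp [Pi.single_eq_of_ne hi]
  · simp

theorem sympForm_add {m n : ℕ} (x y : Fin (m + n) → k × k) :
    sympForm k (m + n) x y =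
      sympForm k m (fun i => x (Fin.castAdd n i)) (fun i => y (Fin.castAdd n i)) +
      sympForm k n (fun i => x (Fin.natAdd m i)) (fun i => y (Fin.natAdd m i)) := by
  simp only [sympForm_apply, Fin.sum_univ_add]

/-- Every linear functional on `(k ⊕ k) ^ n` is represented by the symplectic form. -/
theorem exists_sympForm {n : ℕ} (f : (Fin n → k × k) →ₗ[k] k) :
    ∃ b, ∀ x, f x = sympForm k n x b := by
  refine ⟨fun j => (-f (Pi.single j (0, 1)), f (Pi.single j (1, 0))), fun x => ?_⟩
  suffices h : f = (sympForm k n).flip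
      (fun j => (-f (Pi.single j (0, 1)), f (Pi.single j (1, 0)))) by
    conv_lhs => rw [h]
    rfl
  refine LinearMap.pi_ext fun j v => ?_
  refine Eq.trans ?_ (sympForm_single_left j v _).symm
  have : (Pi.single j v : Fin n → k × k) =
      v.1 • (Pi.single j (1, 0) : Fin n → k × k) + v.2 • (Pi.single j (0, 1) : Fin n → k × k) := by
    rw [← Pi.single_smul, ← Pi.single_smul, ← Pi.single_add]; simp
  rw [this, map_add, map_smul, map_smul, smul_eq_mul, smul_eq_mul]
  ring

theorem sympForm_eq_zero {n : ℕ} {b : Fin n → k × k} (h : ∀ x, sympForm k n x b = 0) : b = 0 := by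
  funext j
  have h1 := h (Pi.single j (1, 0))
  have h2 := h (Pi.single j (0, 1))
  rw [sympForm_single_left] at h1 h2
  ext
  · simpa using h2
  · simpa using h1

theorem isLagrangianRelation_iff {m n : ℕ} (L : LinearRelation k (k × k) m n) :
    IsLagrangianRelation L ↔
      ∀ x y, (x, y) ∈ L ↔ ∀ x' y', (x', y') ∈ L → sympForm k m x x' = sympForm k n y y' := by
  rw [IsLagrangianRelation, isLagrangian_iff fun v => by simp [relForm_apply, sympForm_self]]
  simp only [Prod.forall, relForm_apply, neg_add_eq_zero]

theorem isLagrangianRelation_id (n : ℕ) :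
    IsLagrangianRelation (LinearRelation.id k (k × k) n) := by
  rw [isLagrangianRelation_iff]
  intro x y
  simp only [LinearRelation.mem_id]
  constructor
  · rintro rfl x' _ rfl; rfl
  · intro h
    have : ∀ z, sympForm k n z (x - y) = 0 := fun z => by
      have hz := h z z rfl
      rw [map_sub, sympForm_anti, sympForm_anti z y, hz, sub_self]
    exact sub_eq_zero.1 (sympForm_eq_zero this)

theorem isLagrangianRelation_comp {l m n : ℕ} {L : LinearRelation k (k × k) l m}
    {M : LinearRelation k (k × k) m n} (hL : IsLagrangianRelation L)
    (hM : IsLagrangianRelation M) : IsLagrangianRelation (L.comp M) := by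
  rw [isLagrangianRelation_iff] at *
  intro v u
  constructor
  · rintro ⟨w, h1, h2⟩ v' u' ⟨w', h1', h2'⟩
    rw [(hL v w).1 h1 v' w' h1', (hM w u).1 h2 w' u' h2']
  · intro h
    by_contra hcon
    let D : Submodule k (((Fin l → k × k) × (Fin m → k × k)) ×
        ((Fin m → k × k) × (Fin n → k × k))) :=
      { carrier := {p | p.1.1 = 0 ∧ p.1.2 = p.2.1 ∧ p.2.2 = 0}
        add_mem' := by
          rintro p q ⟨h1, h2, h3⟩ ⟨h1', h2', h3'⟩
          exact ⟨by simp [h1, h1'], by simp [h2, h2'], by simp [h3, h3']⟩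
        zero_mem' := ⟨rfl, rfl, rfl⟩
        smul_mem' := by
          rintro c p ⟨h1, h2, h3⟩
          exact ⟨by simp [h1], by simp [h2], by simp [h3]⟩ }
    have hnot : (((v, 0), (0, u)) : ((Fin l → k × k) × (Fin m → k × k)) ×
        ((Fin m → k × k) × (Fin n → k × k))) ∉ L.prod M ⊔ D := by
      intro hmem
      obtain ⟨⟨⟨a, b⟩, ⟨c, d⟩⟩, hab, ⟨⟨a', w⟩, ⟨w', d'⟩⟩, ⟨ha', hw, hd'⟩, heq⟩ :=
        Submodule.mem_sup.1 hmem
      simp only at ha' hw hd'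
      subst ha' hw hd'
      simp only [Prod.mk_add_mk, add_zero, Prod.mk.injEq] at heq
      obtain ⟨⟨rfl, h1⟩, h2, rfl⟩ := heq
      have hbc : b = c := by
        rw [eq_neg_of_add_eq_zero_left h1, eq_neg_of_add_eq_zero_left h2]
      subst hbc
      exact hcon ⟨b, hab.1, hab.2⟩
    obtain ⟨f, hf, hfD⟩ := Submodule.exists_le_ker_of_notMem hnot
    obtain ⟨a, ha⟩ := exists_sympForm
      (f ∘ₗ LinearMap.inl k _ _ ∘ₗ LinearMap.inl k (Fin l → k × k) (Fin m → k × k))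
    obtain ⟨b, hb⟩ := exists_sympForm
      (f ∘ₗ LinearMap.inl k _ _ ∘ₗ LinearMap.inr k (Fin l → k × k) (Fin m → k × k))
    obtain ⟨c, hc⟩ := exists_sympForm
      (f ∘ₗ LinearMap.inr k _ _ ∘ₗ LinearMap.inl k (Fin m → k × k) (Fin n → k × k))
    obtain ⟨d, hd⟩ := exists_sympForm
      (f ∘ₗ LinearMap.inr k _ _ ∘ₗ LinearMap.inr k (Fin m → k × k) (Fin n → k × k))
    have hfall : ∀ x y z t, f ((x, y), (z, t)) =
        sympForm k l x a + sympForm k m y b + (sympForm k m z c + sympForm k n t d) := by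
      intro x y z t
      rw [← ha, ← hb, ← hc, ← hd]
      simp only [LinearMap.comp_apply, LinearMap.inl_apply, LinearMap.inr_apply, ← map_add]
      simp
    have hbc : b = -c := by
      rw [eq_neg_iff_add_eq_zero]
      refine sympForm_eq_zero fun w => ?_
      have := hfD (Submodule.mem_sup_right (show ((0, w), (w, 0)) ∈ D from ⟨rfl, rfl, rfl⟩))
      rw [LinearMap.mem_ker, hfall] at this
      simpa using this
    have h1 : (-a, b) ∈ L := by
      rw [hL]
      intro x y hxy
      have := hfD (Submodule.mem_sup_left (show ((x, y), (0, 0)) ∈ L.prod M from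
        ⟨hxy, M.zero_mem⟩))
      rw [LinearMap.mem_ker, hfall] at this
      simp only [map_zero, LinearMap.zero_apply, add_zero] at this
      rw [sympForm_anti, sympForm_anti b, map_neg, neg_neg]
      exact eq_neg_of_add_eq_zero_left this
    have h2 : (b, d) ∈ M := by
      rw [hM]
      intro x y hxy
      have := hfD (Submodule.mem_sup_left (show ((0, 0), (x, y)) ∈ L.prod M from
        ⟨L.zero_mem, hxy⟩))
      rw [LinearMap.mem_ker, hfall] at this
      simp only [map_zero, LinearMap.zero_apply, zero_add] at this
      rw [hbc, sympForm_anti, sympForm_anti d, map_neg, neg_neg]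
      exact eq_neg_of_add_eq_zero_left this
    have h3 := h (-a) d ⟨b, h1, h2⟩
    apply hf
    rw [hfall, ← h3]
    simp

theorem isLagrangianRelation_tensor {m n m' n' : ℕ} {L : LinearRelation k (k × k) m n}
    {M : LinearRelation k (k × k) m' n'} (hL : IsLagrangianRelation L)
    (hM : IsLagrangianRelation M) : IsLagrangianRelation (L.tensor M) := by
  rw [isLagrangianRelation_iff] at *
  intro x y
  rw [LinearRelation.mem_tensor]
  simp only [sympForm_add]
  constructor
  · rintro ⟨h1, h2⟩ x' y' ⟨h3, h4⟩
    rw [(hL _ _).1 h1 _ _ h3, (hM _ _).1 h2 _ _ h4]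
  · intro h
    rw [hL, hM]
    constructor
    · intro x' y' h'
      have := h (Fin.append x' 0) (Fin.append y' 0) (by
        rw [LinearRelation.mem_tensor]
        simp only [Fin.append_left, Fin.append_right]
        exact ⟨h', M.zero_mem⟩)
      simp only [Fin.append_left, Fin.append_right] at this
      simpa [sympForm_apply] using this
    · intro x' y' h'
      have := h (Fin.append 0 x') (Fin.append 0 y') (by
        rw [LinearRelation.mem_tensor]
        simp only [Fin.append_left, Fin.append_right]
        exact ⟨L.zero_mem, h'⟩)
      simp only [Fin.append_left, Fin.append_right] at this
      simpa [sympForm_apply] using this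

theorem isLagrangianRelation_braid (m n : ℕ) :
    IsLagrangianRelation (LinearRelation.braid k (k × k) m n) := by
  rw [isLagrangianRelation_iff]
  intro x y
  constructor
  · rintro ⟨h1, h2⟩ x' y' ⟨h1', h2'⟩
    dsimp only at h1 h2 h1' h2'
    rw [sympForm_add, sympForm_add, add_comm]
    simp only [h1, h2, h1', h2']
  · intro h
    let z : Fin (n + m) → k × k :=
      Fin.append (fun i => x (Fin.natAdd m i)) (fun i => x (Fin.castAdd n i))
    have hz : y = z := by
      refine sub_eq_zero.1 (sympForm_eq_zero fun y' => ?_)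
      have := h (Fin.append (fun i => y' (Fin.natAdd n i)) (fun i => y' (Fin.castAdd m i))) y'
        (by simp [LinearRelation.mem_braid])
      rw [sympForm_add] at this
      simp only [Fin.append_left, Fin.append_right] at this
      rw [map_sub, sympForm_anti, ← this, sympForm_anti y' z, sympForm_add z]
      simp only [z, Fin.append_left, Fin.append_right]
      ring
    subst hz
    simp [LinearRelation.mem_braid, z]

theorem coe_castHom {m m' n n' : ℕ} (hm : m = m') (hn : n = n')
    (L : {L : LinearRelation k (k × k) m n // IsLagrangianRelation L}) :
    (castHom (H := fun m n => {L : LinearRelation k (k × k) m n // IsLagrangianRelation L})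
      hm hn L).1 = castHom (H := LinearRelation k (k × k)) hm hn L.1 := by
  subst hm hn; rfl

variable (k) in
/-- The prop of linear Lagrangian relations between the symplectic spaces `(k ⊕ k) ^ n`. -/
def LagRel : PROP.{u} where
  Hom m n := {L : LinearRelation k (k × k) m n // IsLagrangianRelation L}
  id n := ⟨_, isLagrangianRelation_id n⟩
  comp L M := ⟨_, isLagrangianRelation_comp L.2 M.2⟩
  tensor L M := ⟨_, isLagrangianRelation_tensor L.2 M.2⟩
  braid m n := ⟨_, isLagrangianRelation_braid m n⟩
  id_comp f := Subtype.ext ((LinRel k (k × k)).id_comp f.1)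
  comp_id f := Subtype.ext ((LinRel k (k × k)).comp_id f.1)
  assoc f g h := Subtype.ext ((LinRel k (k × k)).assoc f.1 g.1 h.1)
  tensor_id m n := Subtype.ext ((LinRel k (k × k)).tensor_id m n)
  tensor_comp f g f' g' := Subtype.ext ((LinRel k (k × k)).tensor_comp f.1 g.1 f'.1 g'.1)
  tensor_assoc f g h := Subtype.ext
    ((coe_castHom _ _ _).trans ((LinRel k (k × k)).tensor_assoc f.1 g.1 h.1))
  id_zero_tensor f := Subtype.ext
    ((coe_castHom _ _ _).trans ((LinRel k (k × k)).id_zero_tensor f.1))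
  tensor_id_zero f := Subtype.ext
    ((coe_castHom _ _ _).trans ((LinRel k (k × k)).tensor_id_zero f.1))
  braid_natural f g := Subtype.ext ((LinRel k (k × k)).braid_natural f.1 g.1)
  braid_symm m n := Subtype.ext ((LinRel k (k × k)).braid_symm m n)
  braid_zero n := Subtype.ext ((coe_castHom _ _ _).trans ((LinRel k (k × k)).braid_zero n))
  hexagon m n p := Subtype.ext ((coe_castHom _ _ _).trans
    (((LinRel k (k × k)).hexagon m n p).trans
      (congrArg (fun L => LinearRelation.comp L _)
        (coe_castHom (m := m + n + p) (n := n + m + p) rfl (add_assoc n m p)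
          ⟨_, isLagrangianRelation_tensor (isLagrangianRelation_braid m n)
            (isLagrangianRelation_id p)⟩).symm)))

/-- The vector in `(k ⊕ k) ^ n` with entries `((x 0, x 1), (x 2, x 3), …)`. -/
def pairUp {k : Type u} {n : ℕ} (x : Fin (2 * n) → k) : Fin n → k × k :=
  fun j => (x ⟨2 * j, by omega⟩, x ⟨2 * j + 1, by omega⟩)

theorem pairUp_bijective {k : Type u} (n : ℕ) : Function.Bijective (pairUp (k := k) (n := n)) := by
  constructor
  · intro x y h
    funext i
    have hi := congrFun h ⟨i / 2, by omega⟩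
    simp only [pairUp, Prod.mk.injEq] at hi
    rcases Nat.mod_two_eq_zero_or_one i with h0 | h1
    · have : i = ⟨2 * (i / 2), by omega⟩ := Fin.ext (by dsimp only; omega)
      rw [this]; exact hi.1
    · have : i = ⟨2 * (i / 2) + 1, by omega⟩ := Fin.ext (by dsimp only; omega)
      rw [this]; exact hi.2
  · intro z
    refine ⟨fun i => if (i : ℕ) % 2 = 0 then (z ⟨i / 2, by omega⟩).1 else (z ⟨i / 2, by omega⟩).2,
      funext fun j => ?_⟩
    have h1 : (2 * (j : ℕ) + 1) / 2 = j := by omega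
    simp [pairUp, Nat.add_mod, h1]

/-- A relation from `(k ⊕ k) ^ m` to `(k ⊕ k) ^ n`, seen as a relation from `k ^ (2 m)` to
`k ^ (2 n)`. -/
def flattenRelation {m n : ℕ} (L : LinearRelation k (k × k) m n) :
    LinearRelation k k (2 * m) (2 * n) where
  carrier := {p | (pairUp p.1, pairUp p.2) ∈ L}
  add_mem' {_ _} h h' := L.add_mem h h'
  zero_mem' := L.zero_mem
  smul_mem' c _ h := L.smul_mem c h

theorem mem_flattenRelation {m n : ℕ} {L : LinearRelation k (k × k) m n}
    {x : Fin (2 * m) → k} {y : Fin (2 * n) → k} :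
    (x, y) ∈ flattenRelation L ↔ (pairUp x, pairUp y) ∈ L := Iff.rfl

theorem pairUp_castAdd {k : Type u} {m n : ℕ} (x : Fin (2 * (m + n)) → k) :
    pairUp (fun i : Fin (2 * m) => x (Fin.cast (Nat.mul_add 2 m n).symm (Fin.castAdd (2 * n) i))) =
      fun i => pairUp x (Fin.castAdd n i) := rfl

theorem pairUp_natAdd {k : Type u} {m n : ℕ} (x : Fin (2 * (m + n)) → k) :
    pairUp (fun i : Fin (2 * n) => x (Fin.cast (Nat.mul_add 2 m n).symm (Fin.natAdd (2 * m) i))) =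
      fun i => pairUp x (Fin.natAdd m i) := by
  funext j
  refine Prod.ext (congrArg x (Fin.ext ?_)) (congrArg x (Fin.ext ?_)) <;> simp <;> ring

theorem castHom_flattenRelation_tensor {m n m' n' : ℕ} (L : LinearRelation k (k × k) m n)
    (M : LinearRelation k (k × k) m' n') :
    castHom (H := LinearRelation k k) (Nat.mul_add 2 m m') (Nat.mul_add 2 n n')
      (flattenRelation (L.tensor M)) = (flattenRelation L).tensor (flattenRelation M) := by
  refine LinearRelation.ext' fun x y => ?_
  obtain ⟨x, rfl⟩ : ∃ x' : Fin (2 * (m + m')) → k,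
      x = fun i => x' (Fin.cast (Nat.mul_add 2 m m').symm i) :=
    ⟨fun i => x (Fin.cast (Nat.mul_add 2 m m') i), rfl⟩
  obtain ⟨y, rfl⟩ : ∃ y' : Fin (2 * (n + n')) → k,
      y = fun i => y' (Fin.cast (Nat.mul_add 2 n n').symm i) :=
    ⟨fun i => y (Fin.cast (Nat.mul_add 2 n n') i), rfl⟩
  rw [LinearRelation.mem_castHom, LinearRelation.mem_tensor]
  simp only [mem_flattenRelation]
  rw [pairUp_castAdd, pairUp_castAdd, pairUp_natAdd, pairUp_natAdd]
  exact LinearRelation.mem_tensor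

theorem castHom_flattenRelation_braid (m n : ℕ) :
    castHom (H := LinearRelation k k) (Nat.mul_add 2 m n) (Nat.mul_add 2 n m)
      (flattenRelation (LinearRelation.braid k (k × k) m n)) =
        LinearRelation.braid k k (2 * m) (2 * n) := by
  refine LinearRelation.ext' fun x y => ?_
  obtain ⟨x, rfl⟩ : ∃ x' : Fin (2 * (m + n)) → k,
      x = fun i => x' (Fin.cast (Nat.mul_add 2 m n).symm i) :=
    ⟨fun i => x (Fin.cast (Nat.mul_add 2 m n) i), rfl⟩
  obtain ⟨y, rfl⟩ : ∃ y' : Fin (2 * (n + m)) → k,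
      y = fun i => y' (Fin.cast (Nat.mul_add 2 n m).symm i) :=
    ⟨fun i => y (Fin.cast (Nat.mul_add 2 n m) i), rfl⟩
  rw [LinearRelation.mem_castHom, LinearRelation.mem_braid, ← funext_iff, ← funext_iff,
    ← (pairUp_bijective m).1.eq_iff, ← (pairUp_bijective n).1.eq_iff, pairUp_castAdd,
    pairUp_castAdd, pairUp_natAdd, pairUp_natAdd, funext_iff, funext_iff]
  exact LinearRelation.mem_braid (k := k)

variable (k) in
/-- The inclusion of Lagrangian relations in linear relations; it sends the object `n`, which
stands for `(k ⊕ k) ^ n`, to the object `2 n`, which stands for `k ^ (2 n)`. -/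
def LagRel.inclusion : StrictFunctor (LagRel k) (FinRel k) where
  obj n := 2 * n
  map L := flattenRelation L.1
  obj_zero := rfl
  obj_add m n := Nat.mul_add 2 m n
  map_id n := LinearRelation.ext' fun x y => (pairUp_bijective n).1.eq_iff
  map_comp {l m n} L M := LinearRelation.ext' fun x z => by
    constructor
    · rintro ⟨w, h1, h2⟩
      obtain ⟨y, rfl⟩ := (pairUp_bijective m).2 w
      exact ⟨y, h1, h2⟩
    · rintro ⟨y, h1, h2⟩
      exact ⟨pairUp y, h1, h2⟩
  map_tensor L M := castHom_flattenRelation_tensor L.1 M.1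
  map_braid m n := castHom_flattenRelation_braid m n

end LagrangianRelations

section Circuits

/-- An `L`-circuit from `m` to `n`: a finite directed graph with edges labelled by `L`, together
with a cospan of finite sets from `Fin m` to `Fin n` whose apex is the set of nodes. -/
structure Circuit (L : Type u) (m n : ℕ) where
  Node : Type
  Edge : Type
  [finite_node : Finite Node]
  [finite_edge : Finite Edge]
  inp : Fin m → Node
  out : Fin n → Node
  src : Edge → Node
  tgt : Edge → Node
  label : Edge → L

attribute [instance] Circuit.finite_node Circuit.finite_edge

namespace Circuit

variable {L : Type u}

/-- An isomorphism of circuits: bijections of nodes and edges that preserve all the structure. -/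
structure Iso {m n : ℕ} (a b : Circuit L m n) where
  node : a.Node ≃ b.Node
  edge : a.Edge ≃ b.Edge
  inp : ∀ x, node (a.inp x) = b.inp x
  out : ∀ y, node (a.out y) = b.out y
  src : ∀ e, node (a.src e) = b.src (edge e)
  tgt : ∀ e, node (a.tgt e) = b.tgt (edge e)
  label : ∀ e, a.label e = b.label (edge e)

/-- Circuits up to isomorphism. -/
instance setoid (L : Type u) (m n : ℕ) : Setoid (Circuit L m n) where
  r a b := Nonempty (Iso a b)
  iseqv :=
    { refl := fun a => ⟨⟨.refl _, .refl _, fun _ => rfl, fun _ => rfl, fun _ => rfl, fun _ => rfl,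
        fun _ => rfl⟩⟩
      symm := fun ⟨f⟩ => ⟨⟨f.node.symm, f.edge.symm,
        fun x => by rw [← f.inp, Equiv.symm_apply_apply],
        fun x => by rw [← f.out, Equiv.symm_apply_apply],
        fun e => by rw [Equiv.symm_apply_eq, f.src, Equiv.apply_symm_apply],
        fun e => by rw [Equiv.symm_apply_eq, f.tgt, Equiv.apply_symm_apply],
        fun e => by rw [f.label, Equiv.apply_symm_apply]⟩⟩
      trans := fun ⟨f⟩ ⟨g⟩ => ⟨⟨f.node.trans g.node, f.edge.trans g.edge,
        fun x => by simp [f.inp, g.inp], fun x => by simp [f.out, g.out],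
        fun e => by simp [f.src, g.src], fun e => by simp [f.tgt, g.tgt],
        fun e => by rw [f.label, g.label]; rfl⟩⟩ }

/-- The circuit without edges given by a cospan of finite sets. -/
def ofCospan {m n : ℕ} {N : Type} [Finite N] (i : Fin m → N) (o : Fin n → N) : Circuit L m n where
  Node := N
  Edge := Empty
  inp := i
  out := o
  src := Empty.elim
  tgt := Empty.elim
  label := Empty.elim

/-- The circuit with a single edge, labelled by `l`, from its input node to its output node. -/
def ofLabel (l : L) : Circuit L 1 1 where
  Node := Fin 2
  Edge := Unit
  inp _ := 0
  out _ := 1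
  src _ := 0
  tgt _ := 1
  label _ := l

/-- The relation on the disjoint union of the nodes of two composable circuits that glues each
output of the first to the corresponding input of the second. -/
def Glue {l m n : ℕ} (a : Circuit L l m) (b : Circuit L m n) (p q : a.Node ⊕ b.Node) : Prop :=
  ∃ y, p = .inl (a.out y) ∧ q = .inr (b.inp y)

/-- The composite of two circuits: first `a`, then `b`.  Its set of nodes is the pushout of the
sets of nodes over `Fin m`. -/
def comp {l m n : ℕ} (a : Circuit L l m) (b : Circuit L m n) : Circuit L l n where
  Node := Quot (Glue a b)
  Edge := a.Edge ⊕ b.Edge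
  inp x := Quot.mk _ (.inl (a.inp x))
  out y := Quot.mk _ (.inr (b.out y))
  src := Sum.elim (fun e => Quot.mk _ (.inl (a.src e))) fun e => Quot.mk _ (.inr (b.src e))
  tgt := Sum.elim (fun e => Quot.mk _ (.inl (a.tgt e))) fun e => Quot.mk _ (.inr (b.tgt e))
  label := Sum.elim a.label b.label

/-- The tensor product of two circuits: their disjoint union. -/
def tensor {m n m' n' : ℕ} (a : Circuit L m n) (b : Circuit L m' n') :
    Circuit L (m + m') (n + n') where
  Node := a.Node ⊕ b.Node
  Edge := a.Edge ⊕ b.Edge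
  inp := Fin.addCases (fun x => .inl (a.inp x)) fun x => .inr (b.inp x)
  out := Fin.addCases (fun y => .inl (a.out y)) fun y => .inr (b.out y)
  src := Sum.map a.src b.src
  tgt := Sum.map a.tgt b.tgt
  label := Sum.elim a.label b.label

/-- Relabelling of the inputs and the outputs of a circuit. -/
def reindex {m n m' n' : ℕ} (a : Circuit L m n) (i : Fin m' → Fin m) (o : Fin n' → Fin n) :
    Circuit L m' n' where
  Node := a.Node
  Edge := a.Edge
  inp x := a.inp (i x)
  out y := a.out (o y)
  src := a.src
  tgt := a.tgt
  label := a.label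

/-- The identity circuit. -/
def id (L : Type u) (n : ℕ) : Circuit L n n :=
  ofCospan (fun i => i) fun i => i

/-- The function that exchanges the two summands of `Fin (m + n)`. -/
def swap (m n : ℕ) : Fin (m + n) → Fin (n + m) :=
  Fin.addCases (Fin.natAdd n) (Fin.castAdd m)

/-- The circuit without edges that exchanges `m` wires with `n` wires. -/
def braid (L : Type u) (m n : ℕ) : Circuit L (m + n) (n + m) :=
  ofCospan (swap m n) fun i => i

theorem tensor_inp_left {m n m' n' : ℕ} (a : Circuit L m n) (b : Circuit L m' n') (i : Fin m) :
    (tensor a b).inp (Fin.castAdd m' i) = Sum.inl (a.inp i) := by simp [tensor]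

theorem tensor_inp_right {m n m' n' : ℕ} (a : Circuit L m n) (b : Circuit L m' n') (i : Fin m') :
    (tensor a b).inp (Fin.natAdd m i) = Sum.inr (b.inp i) := by simp [tensor]

theorem tensor_out_left {m n m' n' : ℕ} (a : Circuit L m n) (b : Circuit L m' n') (i : Fin n) :
    (tensor a b).out (Fin.castAdd n' i) = Sum.inl (a.out i) := by simp [tensor]

theorem tensor_out_right {m n m' n' : ℕ} (a : Circuit L m n) (b : Circuit L m' n') (i : Fin n') :
    (tensor a b).out (Fin.natAdd n i) = Sum.inr (b.out i) := by simp [tensor]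

theorem swap_castAdd {m n : ℕ} (i : Fin m) : swap m n (Fin.castAdd n i) = Fin.natAdd n i :=
  Fin.addCases_left i

theorem swap_natAdd {m n : ℕ} (i : Fin n) : swap m n (Fin.natAdd m i) = Fin.castAdd m i :=
  Fin.addCases_right i

theorem comp_sound {l m n : ℕ} {a a' : Circuit L l m} {b b' : Circuit L m n} (f : Iso a a')
    (g : Iso b b') : comp a b ≈ comp a' b' := by
  refine ⟨⟨Quot.congr (Equiv.sumCongr f.node g.node) ?_, Equiv.sumCongr f.edge g.edge,
    fun x => ?_, fun x => ?_, ?_, ?_, ?_⟩⟩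
  · intro p q
    refine exists_congr fun y => ?_
    rw [← f.out, ← g.inp]
    rcases p with p | p <;> rcases q with q | q <;> simp
  · exact congrArg (fun t => Quot.mk _ (Sum.inl t)) (f.inp x)
  · exact congrArg (fun t => Quot.mk _ (Sum.inr t)) (g.out x)
  · rintro (e | e)
    · exact congrArg (fun t => Quot.mk _ (Sum.inl t)) (f.src e)
    · exact congrArg (fun t => Quot.mk _ (Sum.inr t)) (g.src e)
  · rintro (e | e)
    · exact congrArg (fun t => Quot.mk _ (Sum.inl t)) (f.tgt e)
    · exact congrArg (fun t => Quot.mk _ (Sum.inr t)) (g.tgt e)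
  · rintro (e | e)
    · exact f.label e
    · exact g.label e

theorem tensor_sound {m n m' n' : ℕ} {a a' : Circuit L m n} {b b' : Circuit L m' n'}
    (f : Iso a a') (g : Iso b b') : tensor a b ≈ tensor a' b' := by
  refine ⟨⟨Equiv.sumCongr f.node g.node, Equiv.sumCongr f.edge g.edge, ?_, ?_, ?_, ?_, ?_⟩⟩
  · refine LinearRelation.forall_fin_add.2 ⟨fun i => ?_, fun i => ?_⟩
    · rw [tensor_inp_left, tensor_inp_left]; exact congrArg Sum.inl (f.inp i)
    · rw [tensor_inp_right, tensor_inp_right]; exact congrArg Sum.inr (g.inp i)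
  · refine LinearRelation.forall_fin_add.2 ⟨fun i => ?_, fun i => ?_⟩
    · rw [tensor_out_left, tensor_out_left]; exact congrArg Sum.inl (f.out i)
    · rw [tensor_out_right, tensor_out_right]; exact congrArg Sum.inr (g.out i)
  · rintro (e | e)
    · exact congrArg Sum.inl (f.src e)
    · exact congrArg Sum.inr (g.src e)
  · rintro (e | e)
    · exact congrArg Sum.inl (f.tgt e)
    · exact congrArg Sum.inr (g.tgt e)
  · rintro (e | e)
    · exact f.label e
    · exact g.label e

theorem comp_congr {l m n : ℕ} ⦃a a' : Circuit L l m⦄ (h : a ≈ a') ⦃b b' : Circuit L m n⦄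
    (h' : b ≈ b') : comp a b ≈ comp a' b' := by
  obtain ⟨f⟩ := h
  obtain ⟨g⟩ := h'
  exact comp_sound f g

theorem tensor_congr {m n m' n' : ℕ} ⦃a a' : Circuit L m n⦄ (h : a ≈ a')
    ⦃b b' : Circuit L m' n'⦄ (h' : b ≈ b') : tensor a b ≈ tensor a' b' := by
  obtain ⟨f⟩ := h
  obtain ⟨g⟩ := h'
  exact tensor_sound f g

theorem reindex_sound {m n m' n' : ℕ} {a a' : Circuit L m n} (f : Iso a a') (i : Fin m' → Fin m)
    (o : Fin n' → Fin n) : reindex a i o ≈ reindex a' i o :=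
  ⟨⟨f.node, f.edge, fun _ => f.inp _, fun _ => f.out _, f.src, f.tgt, f.label⟩⟩

/-- Precomposition with a function amounts to a relabelling of the inputs. -/
theorem ofCospan_comp {l m n : ℕ} (i : Fin l → Fin m) (b : Circuit L m n) :
    comp (ofCospan i fun x => x) b ≈ reindex b i fun y => y := by
  refine ⟨⟨⟨Quot.lift (Sum.elim b.inp fun p => p) ?_, fun p => Quot.mk _ (.inr p), ?_, fun p => rfl⟩,
    Equiv.emptySum Empty _, fun x => rfl, fun x => rfl, ?_, ?_, ?_⟩⟩
  · rintro _ _ ⟨y, rfl, rfl⟩; rfl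
  · rintro ⟨p | p⟩
    · exact (Quot.sound ⟨p, rfl, rfl⟩).symm
    · rfl
  all_goals
    rintro (e | e)
    · exact e.elim
    · rfl

/-- Postcomposition with a reversed function amounts to a relabelling of the outputs. -/
theorem comp_ofCospan {l m n : ℕ} (a : Circuit L l m) (o : Fin n → Fin m) :
    comp a (ofCospan (fun x => x) o) ≈ reindex a (fun x => x) o := by
  refine ⟨⟨⟨Quot.lift (Sum.elim (fun p => p) a.out) ?_, fun p => Quot.mk _ (.inl p), ?_, fun p => rfl⟩,
    Equiv.sumEmpty _ Empty, fun x => rfl, fun x => rfl, ?_, ?_, ?_⟩⟩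
  · rintro _ _ ⟨y, rfl, rfl⟩; rfl
  · rintro ⟨p | p⟩
    · rfl
    · exact Quot.sound ⟨p, rfl, rfl⟩
  all_goals
    rintro (e | e)
    · rfl
    · exact e.elim

theorem comp_assoc {l m n p : ℕ} (a : Circuit L l m) (b : Circuit L m n) (c : Circuit L n p) :
    comp (comp a b) c ≈ comp a (comp b c) := by
  refine ⟨⟨⟨?_, ?_, ?_, ?_⟩, Equiv.sumAssoc _ _ _, ?_, ?_, ?_, ?_, ?_⟩⟩
  · refine Quot.lift (Sum.elim (Quot.lift (Sum.elim (fun x => Quot.mk _ (.inl x))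
      fun x => Quot.mk _ (.inr (Quot.mk _ (.inl x)))) ?_)
      fun x => Quot.mk _ (.inr (Quot.mk _ (.inr x)))) ?_
    · rintro _ _ ⟨y, rfl, rfl⟩
      exact Quot.sound ⟨y, rfl, rfl⟩
    · rintro _ _ ⟨y, rfl, rfl⟩
      exact congrArg (fun t => Quot.mk _ (Sum.inr t)) (Quot.sound ⟨y, rfl, rfl⟩)
  · refine Quot.lift (Sum.elim (fun x => Quot.mk _ (.inl (Quot.mk _ (.inl x))))
      (Quot.lift (Sum.elim (fun x => Quot.mk _ (.inl (Quot.mk _ (.inr x))))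
        fun x => Quot.mk _ (.inr x)) ?_)) ?_
    · rintro _ _ ⟨y, rfl, rfl⟩
      exact Quot.sound ⟨y, rfl, rfl⟩
    · rintro _ _ ⟨y, rfl, rfl⟩
      exact congrArg (fun t => Quot.mk _ (Sum.inl t)) (Quot.sound ⟨y, rfl, rfl⟩)
  · rintro ⟨⟨⟨x | x⟩⟩ | x⟩ <;> rfl
  · rintro ⟨x | ⟨⟨x | x⟩⟩⟩ <;> rfl
  · intro x; rfl
  · intro x; rfl
  all_goals rintro ((e | e) | e) <;> rfl

theorem tensor_comp {l m n l' m' n' : ℕ} (a : Circuit L l m) (b : Circuit L m n)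
    (c : Circuit L l' m') (d : Circuit L m' n') :
    tensor (comp a b) (comp c d) ≈ comp (tensor a c) (tensor b d) := by
  refine ⟨⟨⟨?_, ?_, ?_, ?_⟩, Equiv.sumSumSumComm _ _ _ _, ?_, ?_, ?_, ?_, ?_⟩⟩
  · refine Sum.elim (Quot.map (Sum.map .inl .inl) ?_) (Quot.map (Sum.map .inr .inr) ?_)
    · rintro _ _ ⟨y, rfl, rfl⟩
      exact ⟨Fin.castAdd m' y, congrArg Sum.inl (tensor_out_left a c y).symm,
        congrArg Sum.inr (tensor_inp_left b d y).symm⟩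
    · rintro _ _ ⟨y, rfl, rfl⟩
      exact ⟨Fin.natAdd m y, congrArg Sum.inl (tensor_out_right a c y).symm,
        congrArg Sum.inr (tensor_inp_right b d y).symm⟩
  · refine Quot.lift (Sum.elim
      (Sum.map (fun x => Quot.mk _ (.inl x)) fun x => Quot.mk _ (.inl x))
      (Sum.map (fun x => Quot.mk _ (.inr x)) fun x => Quot.mk _ (.inr x))) ?_
    rintro _ _ ⟨y, rfl, rfl⟩
    refine Fin.addCases (fun y => ?_) (fun y => ?_) y
    · rw [tensor_out_left, tensor_inp_left]
      exact congrArg Sum.inl (Quot.sound ⟨y, rfl, rfl⟩)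
    · rw [tensor_out_right, tensor_inp_right]
      exact congrArg Sum.inr (Quot.sound ⟨y, rfl, rfl⟩)
  · rintro (⟨⟨x | x⟩⟩ | ⟨⟨x | x⟩⟩) <;> rfl
  · rintro ⟨(x | x) | (x | x)⟩ <;> rfl
  · refine LinearRelation.forall_fin_add.2 ⟨fun i => ?_, fun i => ?_⟩
    · rw [tensor_inp_left]
      exact congrArg (fun t => Quot.mk _ (Sum.inl t)) (tensor_inp_left a c i).symm
    · rw [tensor_inp_right]
      exact congrArg (fun t => Quot.mk _ (Sum.inl t)) (tensor_inp_right a c i).symm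
  · refine LinearRelation.forall_fin_add.2 ⟨fun i => ?_, fun i => ?_⟩
    · rw [tensor_out_left]
      exact congrArg (fun t => Quot.mk _ (Sum.inr t)) (tensor_out_left b d i).symm
    · rw [tensor_out_right]
      exact congrArg (fun t => Quot.mk _ (Sum.inr t)) (tensor_out_right b d i).symm
  all_goals rintro ((e | e) | (e | e)) <;> rfl

theorem tensor_assoc {m n m' n' m'' n'' : ℕ} (a : Circuit L m n) (b : Circuit L m' n')
    (c : Circuit L m'' n'') :
    reindex (tensor (tensor a b) c) (Fin.cast (add_assoc m m' m'').symm)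
      (Fin.cast (add_assoc n n' n'').symm) ≈ tensor a (tensor b c) := by
  refine ⟨⟨Equiv.sumAssoc _ _ _, Equiv.sumAssoc _ _ _, ?_, ?_, ?_, ?_, ?_⟩⟩
  · refine LinearRelation.forall_fin_add.2 ⟨fun i => ?_, LinearRelation.forall_fin_add.2
      ⟨fun i => ?_, fun i => ?_⟩⟩
    · refine (congrArg (fun t => Equiv.sumAssoc _ _ _ ((tensor (tensor a b) c).inp t))
        LinearRelation.cast_symm_castAdd).trans ?_
      rw [tensor_inp_left, tensor_inp_left, tensor_inp_left]; rfl
    · refine (congrArg (fun t => Equiv.sumAssoc _ _ _ ((tensor (tensor a b) c).inp t))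
        LinearRelation.cast_symm_natAdd_castAdd).trans ?_
      rw [tensor_inp_left, tensor_inp_right, tensor_inp_right, tensor_inp_left]; rfl
    · refine (congrArg (fun t => Equiv.sumAssoc _ _ _ ((tensor (tensor a b) c).inp t))
        LinearRelation.cast_symm_natAdd_natAdd).trans ?_
      rw [tensor_inp_right, tensor_inp_right, tensor_inp_right]; rfl
  · refine LinearRelation.forall_fin_add.2 ⟨fun i => ?_, LinearRelation.forall_fin_add.2
      ⟨fun i => ?_, fun i => ?_⟩⟩
    · refine (congrArg (fun t => Equiv.sumAssoc _ _ _ ((tensor (tensor a b) c).out t))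
        LinearRelation.cast_symm_castAdd).trans ?_
      rw [tensor_out_left, tensor_out_left, tensor_out_left]; rfl
    · refine (congrArg (fun t => Equiv.sumAssoc _ _ _ ((tensor (tensor a b) c).out t))
        LinearRelation.cast_symm_natAdd_castAdd).trans ?_
      rw [tensor_out_left, tensor_out_right, tensor_out_right, tensor_out_left]; rfl
    · refine (congrArg (fun t => Equiv.sumAssoc _ _ _ ((tensor (tensor a b) c).out t))
        LinearRelation.cast_symm_natAdd_natAdd).trans ?_
      rw [tensor_out_right, tensor_out_right, tensor_out_right]; rfl
  all_goals rintro ((e | e) | e) <;> rfl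

theorem tensor_ofCospan {m n m' n' : ℕ} {N N' : Type} [Finite N] [Finite N'] (i : Fin m → N)
    (o : Fin n → N) (i' : Fin m' → N') (o' : Fin n' → N') :
    tensor (ofCospan (L := L) i o) (ofCospan i' o') ≈
      ofCospan (N := N ⊕ N') (Fin.addCases (fun x => .inl (i x)) fun x => .inr (i' x))
        (Fin.addCases (fun x => .inl (o x)) fun x => .inr (o' x)) :=
  ⟨⟨.refl _, Equiv.sumEmpty Empty Empty, fun _ => rfl, fun _ => rfl, by rintro (⟨⟨⟩⟩ | ⟨⟨⟩⟩),
    by rintro (⟨⟨⟩⟩ | ⟨⟨⟩⟩), by rintro (⟨⟨⟩⟩ | ⟨⟨⟩⟩)⟩⟩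

theorem ofCospan_congr {m n : ℕ} {N N' : Type} [Finite N] [Finite N'] {i : Fin m → N}
    {o : Fin n → N} {i' : Fin m → N'} {o' : Fin n → N'} (f : N ≃ N') (hi : ∀ x, f (i x) = i' x)
    (ho : ∀ x, f (o x) = o' x) : ofCospan (L := L) i o ≈ ofCospan i' o' :=
  ⟨⟨f, .refl _, hi, ho, nofun, nofun, nofun⟩⟩

theorem id_zero_tensor {m n : ℕ} (a : Circuit L m n) :
    reindex (tensor (id L 0) a) (Fin.cast (zero_add m).symm) (Fin.cast (zero_add n).symm) ≈ a := by
  have h : ∀ {n : ℕ} (i : Fin n), Fin.cast (zero_add n).symm i = Fin.natAdd 0 i :=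
    fun i => Fin.ext (zero_add _).symm
  refine ⟨⟨Equiv.emptySum (Fin 0) _, Equiv.emptySum Empty _, ?_, ?_, ?_, ?_, ?_⟩⟩
  · intro x
    refine (congrArg (fun t => Equiv.emptySum (Fin 0) _ ((tensor (id L 0) a).inp t)) (h x)).trans ?_
    rw [tensor_inp_right]; rfl
  · intro x
    refine (congrArg (fun t => Equiv.emptySum (Fin 0) _ ((tensor (id L 0) a).out t)) (h x)).trans ?_
    rw [tensor_out_right]; rfl
  all_goals rintro (⟨⟨⟩⟩ | e); rfl

theorem tensor_id_zero {m n : ℕ} (a : Circuit L m n) : tensor a (id L 0) ≈ a := by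
  refine ⟨⟨Equiv.sumEmpty _ (Fin 0), Equiv.sumEmpty _ Empty, ?_, ?_, ?_, ?_, ?_⟩⟩
  · refine LinearRelation.forall_fin_add.2 ⟨fun i => ?_, fun i => i.elim0⟩
    rw [tensor_inp_left]; rfl
  · refine LinearRelation.forall_fin_add.2 ⟨fun i => ?_, fun i => i.elim0⟩
    rw [tensor_out_left]; rfl
  all_goals
    rintro (e | ⟨⟨⟩⟩)
    rfl

theorem swap_swap {m n : ℕ} (x : Fin (m + n)) : swap n m (swap m n x) = x := by
  refine Fin.addCases (fun i => ?_) (fun i => ?_) x <;> simp [swap]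

/-- The map that exchanges the two summands, as a bijection. -/
def swapEquiv (m n : ℕ) : Fin (m + n) ≃ Fin (n + m) := ⟨swap m n, swap n m, swap_swap, swap_swap⟩

theorem braid_eq (m n : ℕ) : braid L m n ≈ ofCospan (fun x => x) (swap n m) :=
  ofCospan_congr (swapEquiv n m) swap_swap fun _ => rfl

theorem tensor_swap {m n m' n' : ℕ} (a : Circuit L m n) (b : Circuit L m' n') :
    reindex (tensor a b) (fun x => x) (swap n' n) ≈
      reindex (tensor b a) (swap m m') fun x => x := by
  refine ⟨⟨Equiv.sumComm _ _, Equiv.sumComm _ _, ?_, ?_, ?_, ?_, ?_⟩⟩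
  · refine LinearRelation.forall_fin_add.2 ⟨fun i => ?_, fun i => ?_⟩ <;> simp only [reindex]
    · rw [swap_castAdd, tensor_inp_left, tensor_inp_right]; rfl
    · rw [swap_natAdd, tensor_inp_right, tensor_inp_left]; rfl
  · refine LinearRelation.forall_fin_add.2 ⟨fun i => ?_, fun i => ?_⟩ <;> simp only [reindex]
    · rw [swap_castAdd, tensor_out_left, tensor_out_right]; rfl
    · rw [swap_natAdd, tensor_out_right, tensor_out_left]; rfl
  all_goals rintro (e | e) <;> rfl

/-- The sum of two functions between finite ordinals. -/
def sumMap {m n m' n' : ℕ} (i : Fin m → Fin n) (i' : Fin m' → Fin n') :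
    Fin (m + m') → Fin (n + n') :=
  Fin.addCases (fun x => Fin.castAdd n' (i x)) fun x => Fin.natAdd n (i' x)

theorem tensor_ofCospan_fun {m n m' n' : ℕ} (i : Fin m → Fin n) (i' : Fin m' → Fin n') :
    tensor (ofCospan (L := L) i fun x => x) (ofCospan i' fun x => x) ≈
      ofCospan (sumMap i i') fun x => x := by
  refine Setoid.trans (tensor_ofCospan _ _ _ _) (ofCospan_congr finSumFinEquiv
    (LinearRelation.forall_fin_add.2 ⟨fun x => ?_, fun x => ?_⟩)
    (LinearRelation.forall_fin_add.2 ⟨fun x => ?_, fun x => ?_⟩)) <;> simp [sumMap]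

theorem hexagon_fun (m n p : ℕ) : ∀ x : Fin (m + n + p),
    Fin.cast (add_assoc n p m).symm (sumMap (fun x => x) (swap m p)
      (Fin.cast (add_assoc n m p) (sumMap (swap m n) (fun x => x) x))) =
    swap m (n + p) (Fin.cast (add_assoc m n p) x) := by
  refine LinearRelation.forall_fin_add.2 ⟨LinearRelation.forall_fin_add.2
    ⟨fun i => ?_, fun i => ?_⟩, fun i => ?_⟩
  · rw [LinearRelation.cast_castAdd_castAdd, swap_castAdd]
    simp only [sumMap, Fin.addCases_left, swap_castAdd, LinearRelation.cast_castAdd_natAdd,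
      Fin.addCases_right]
    exact LinearRelation.cast_symm_natAdd_natAdd
  · rw [LinearRelation.cast_castAdd_natAdd, swap_natAdd]
    simp only [sumMap, Fin.addCases_left, swap_natAdd, LinearRelation.cast_castAdd_castAdd]
    exact LinearRelation.cast_symm_castAdd
  · rw [LinearRelation.cast_natAdd, swap_natAdd]
    simp only [sumMap, swap_natAdd, LinearRelation.cast_natAdd, Fin.addCases_right]
    exact LinearRelation.cast_symm_natAdd_castAdd

theorem hexagon_aux (m n p : ℕ) :
    reindex (braid L m (n + p)) (Fin.cast (add_assoc m n p).symm.symm)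
      (Fin.cast (add_assoc n p m).symm) ≈
    comp (reindex (tensor (braid L m n) (id L p)) (Fin.cast rfl)
      (Fin.cast (add_assoc n m p).symm)) (tensor (id L n) (braid L m p)) := by
  have h1 : reindex (tensor (braid L m n) (id L p)) (Fin.cast rfl)
      (Fin.cast (add_assoc n m p).symm) ≈
      ofCospan (fun x => Fin.cast (add_assoc n m p) (sumMap (swap m n) (fun x => x) x))
        fun x => x := by
    obtain ⟨f⟩ := tensor_ofCospan_fun (L := L) (swap m n) (fun x : Fin p => x)
    exact Setoid.trans (reindex_sound f _ _)
      (ofCospan_congr (finCongr (add_assoc n m p)) (fun _ => rfl) fun _ => rfl)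
  obtain ⟨f⟩ := h1
  obtain ⟨g⟩ := Setoid.refl (tensor (id L n) (braid L m p))
  obtain ⟨h⟩ := tensor_ofCospan_fun (L := L) (fun x : Fin n => x) (swap m p)
  refine Setoid.symm (Setoid.trans (comp_sound f g) (Setoid.trans (ofCospan_comp _ _)
    (Setoid.trans (reindex_sound h _ _) ?_)))
  exact ofCospan_congr (finCongr (add_assoc n p m).symm) (hexagon_fun m n p) fun _ => rfl

end Circuit

/-- Isomorphism classes of `L`-circuits from `m` to `n`. -/
def CircHom (L : Type u) (m n : ℕ) : Type (max u 1) := Quotient (Circuit.setoid L m n)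

theorem castHom_mk {L : Type u} {m m' n n' : ℕ} (hm : m = m') (hn : n = n') (a : Circuit L m n) :
    castHom (H := CircHom L) hm hn (Quotient.mk _ a) =
      Quotient.mk _ (a.reindex (Fin.cast hm.symm) (Fin.cast hn.symm)) := by
  subst hm hn; rfl

/-- The prop of `L`-circuits. -/
def Circ (L : Type u) : PROP.{max u 1} where
  Hom := CircHom L
  id n := Quotient.mk _ (Circuit.id L n)
  comp := Quotient.map₂ Circuit.comp Circuit.comp_congr
  tensor := Quotient.map₂ Circuit.tensor Circuit.tensor_congr
  braid m n := Quotient.mk _ (Circuit.braid L m n)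
  id_comp := by rintro m n ⟨a⟩; exact Quotient.sound (Circuit.ofCospan_comp _ a)
  comp_id := by rintro m n ⟨a⟩; exact Quotient.sound (Circuit.comp_ofCospan a _)
  assoc := by rintro _ _ _ _ ⟨a⟩ ⟨b⟩ ⟨c⟩; exact Quotient.sound (Circuit.comp_assoc a b c)
  tensor_id m n := Quotient.sound (Setoid.trans (Circuit.tensor_ofCospan _ _ _ _)
    (Circuit.ofCospan_congr finSumFinEquiv
      (fun x => by refine Fin.addCases (fun i => ?_) (fun i => ?_) x <;> simp)
      (fun x => by refine Fin.addCases (fun i => ?_) (fun i => ?_) x <;> simp)))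
  tensor_comp := by
    rintro _ _ _ _ _ _ ⟨a⟩ ⟨b⟩ ⟨c⟩ ⟨d⟩; exact Quotient.sound (Circuit.tensor_comp a b c d)
  tensor_assoc := by
    rintro _ _ _ _ _ _ ⟨a⟩ ⟨b⟩ ⟨c⟩
    exact (castHom_mk _ _ _).trans (Quotient.sound (Circuit.tensor_assoc a b c))
  id_zero_tensor := by
    rintro _ _ ⟨a⟩
    exact (castHom_mk _ _ _).trans (Quotient.sound (Circuit.id_zero_tensor a))
  tensor_id_zero := by
    rintro _ _ ⟨a⟩
    exact (castHom_mk _ _ _).trans (Quotient.sound (Circuit.tensor_id_zero a))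
  braid_natural := by
    rintro m n m' n' ⟨a⟩ ⟨b⟩
    refine Quotient.sound ?_
    obtain ⟨f⟩ := Circuit.braid_eq (L := L) n n'
    obtain ⟨g⟩ := Setoid.refl (Circuit.tensor a b)
    exact Setoid.trans (Circuit.comp_sound g f) (Setoid.trans (Circuit.comp_ofCospan _ _)
      (Setoid.trans (Circuit.tensor_swap a b) (Setoid.symm (Circuit.ofCospan_comp _ _))))
  braid_symm m n := Quotient.sound (Setoid.trans (Circuit.ofCospan_comp _ _)
    (Circuit.ofCospan_congr (.refl _) (fun x => Circuit.swap_swap x) fun _ => rfl))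
  braid_zero n := (castHom_mk _ _ _).trans (Quotient.sound
    (Circuit.ofCospan_congr (.refl _) (fun x => by
      have : Fin.cast (zero_add n).symm x = Fin.natAdd 0 x := Fin.ext (zero_add _).symm
      exact (congrArg (Circuit.swap 0 n) this).trans (Circuit.swap_natAdd x)) fun _ => rfl))
  hexagon m n p := (castHom_mk _ _ _).trans ((Quotient.sound (Circuit.hexagon_aux m n p)).trans
    (congrArg (fun t => Quotient.map₂ Circuit.comp Circuit.comp_congr t
        (Quotient.mk _ (Circuit.tensor (Circuit.id L n) (Circuit.braid L m p))))
      (castHom_mk _ _ _).symm))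

end Circuits

section BlackBoxing

variable {k : Type u} [Field k]

/-- Solvability criterion for a system of linear equations over a field. -/
theorem exists_solution {ι : Type} [Fintype ι] {U : Type u} [AddCommGroup U] [Module k U]
    (A : U →ₗ[k] (ι → k)) (b : ι → k)
    (h : ∀ c : ι → k, (∀ u, ∑ i, c i * A u i = 0) → ∑ i, c i * b i = 0) : ∃ u, A u = b := by
  classical
  by_contra hb
  obtain ⟨f, hfb, hf⟩ := Submodule.exists_le_ker_of_notMem (p := LinearMap.range A) (v := b) hb
  have hfs : ∀ v : ι → k, f v = ∑ i, f (Pi.single i 1) * v i := fun v => by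
    rw [LinearMap.pi_apply_eq_sum_univ f v]
    refine Finset.sum_congr rfl fun i _ => ?_
    rw [smul_eq_mul, mul_comm]
    congr 2
    funext j
    simp [Pi.single_apply, eq_comm]
  refine hfb ((hfs b).trans (h (fun i => f (Pi.single i 1)) fun u => ?_))
  rw [← hfs]
  exact hf ⟨u, rfl⟩

open Classical in
/-- The linear map that sums a function along the fibres of `g`. -/
noncomputable def push {ι N : Type} [Fintype ι] (g : ι → N) : (ι → k) →ₗ[k] (N → k) where
  toFun h p := ∑ i, if g i = p then h i else 0
  map_add' h h' := by
    funext p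
    rw [Pi.add_apply, ← Finset.sum_add_distrib]
    exact Finset.sum_congr rfl fun i _ => by split_ifs <;> simp
  map_smul' c h := by
    funext p
    rw [Pi.smul_apply, Finset.smul_sum]
    exact Finset.sum_congr rfl fun i _ => by split_ifs <;> simp

theorem sum_mul_push {ι N : Type} [Fintype ι] [Fintype N] (g : ι → N) (h : ι → k) (f : N → k) :
    ∑ p, f p * push g h p = ∑ i, f (g i) * h i := by
  classical
  simp only [push, LinearMap.coe_mk, AddHom.coe_mk, Finset.mul_sum]
  rw [Finset.sum_comm]
  exact Finset.sum_congr rfl fun i _ => by simp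

theorem finsum_fibre {ι N : Type} [Fintype ι] (g : ι → N) (h : ι → k) (p : N) :
    ∑ᶠ (i) (_ : g i = p), h i = push g h p := by
  classical
  rw [finsum_eq_sum_of_fintype]
  exact Finset.sum_congr rfl fun i _ => finsum_eq_if

namespace Circuit

/-- The laws obeyed by the potentials and currents in a linear circuit: `x` and `y` give the
potential and the current at each input and at each output, `φ` the potentials at the nodes, and
`J` the currents along the edges. -/
structure IsState {m n : ℕ} (c : Circuit k m n) (x : Fin m → k × k) (y : Fin n → k × k)
    (φ : c.Node → k) (J : c.Edge → k) : Prop where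
  inp : ∀ i, φ (c.inp i) = (x i).1
  out : ∀ j, φ (c.out j) = (y j).1
  /-- Ohm's law: the voltage across an edge is the impedance times the current through it. -/
  ohm : ∀ e, φ (c.tgt e) - φ (c.src e) = c.label e * J e
  /-- Kirchhoff's current law: the current that flows into a node flows out of it. -/
  kirchhoff : ∀ p,
    ∑ᶠ (i) (_ : c.inp i = p), (x i).2 + ∑ᶠ (e) (_ : c.tgt e = p), J e =
      ∑ᶠ (j) (_ : c.out j = p), (y j).2 + ∑ᶠ (e) (_ : c.src e = p), J e

theorem kirchhoff_iff {m n : ℕ} (c : Circuit k m n) [Fintype c.Edge] (I : Fin m → k) (I' : Fin n → k)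
    (J : c.Edge → k) :
    (∀ p, ∑ᶠ (i) (_ : c.inp i = p), I i + ∑ᶠ (e) (_ : c.tgt e = p), J e =
      ∑ᶠ (j) (_ : c.out j = p), I' j + ∑ᶠ (e) (_ : c.src e = p), J e) ↔
    ∀ f : c.Node → k, ∑ i, f (c.inp i) * I i + ∑ e, (f (c.tgt e) - f (c.src e)) * J e =
      ∑ j, f (c.out j) * I' j := by
  classical
  have := Fintype.ofFinite c.Node
  simp only [finsum_fibre, sub_mul, Finset.sum_sub_distrib]
  have e (f : c.Node → k) : (∑ i, f (c.inp i) * I i +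
      (∑ e, f (c.tgt e) * J e - ∑ e, f (c.src e) * J e) = ∑ j, f (c.out j) * I' j) ↔
      (∑ p, f p * push c.inp I p + (∑ p, f p * push c.tgt J p - ∑ p, f p * push c.src J p) =
        ∑ p, f p * push c.out I' p) := by simp only [sum_mul_push]
  simp only [e]
  constructor
  · intro h f
    have h' : ∑ p, f p * (push c.inp I p + push c.tgt J p) =
        ∑ p, f p * (push c.out I' p + push c.src J p) :=
      Finset.sum_congr rfl fun p _ => by rw [h p]
    simp only [mul_add, Finset.sum_add_distrib] at h'
    rw [← add_sub_assoc, h', add_sub_cancel_right]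
  · intro h p
    have h' := h (Pi.single p 1)
    simp only [Pi.single_apply, ite_mul, one_mul, zero_mul, Finset.sum_ite_eq', Finset.mem_univ,
      if_true] at h'
    rw [← h']
    ring

theorem isState_iff {m n : ℕ} (c : Circuit k m n) [Fintype c.Edge] (x : Fin m → k × k)
    (y : Fin n → k × k) (φ : c.Node → k) (J : c.Edge → k) :
    IsState c x y φ J ↔ (∀ i, φ (c.inp i) = (x i).1) ∧ (∀ j, φ (c.out j) = (y j).1) ∧
      (∀ e, φ (c.tgt e) - φ (c.src e) = c.label e * J e) ∧
      ∀ f : c.Node → k, ∑ i, f (c.inp i) * (x i).2 + ∑ e, (f (c.tgt e) - f (c.src e)) * J e =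
        ∑ j, f (c.out j) * (y j).2 := by
  rw [← kirchhoff_iff]
  exact ⟨fun h => ⟨h.1, h.2, h.3, h.4⟩, fun h => ⟨h.1, h.2.1, h.2.2.1, h.2.2.2⟩⟩

/-- The behaviour of a linear circuit: the relation between the potentials and currents at its
inputs and those at its outputs. -/
def behavior {m n : ℕ} (c : Circuit k m n) : LinearRelation k (k × k) m n where
  carrier := {p | ∃ φ J, IsState c p.1 p.2 φ J}
  add_mem' := by
    have := Fintype.ofFinite c.Edge
    rintro p q ⟨φ, J, h⟩ ⟨φ', J', h'⟩
    rw [isState_iff] at h h'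
    refine ⟨φ + φ', J + J', (isState_iff _ _ _ _ _).2 ⟨fun i => ?_, fun i => ?_, fun e => ?_,
      fun f => ?_⟩⟩
    · simp [h.1, h'.1]
    · simp [h.2.1, h'.2.1]
    · simp only [Pi.add_apply, mul_add, ← h.2.2.1, ← h'.2.2.1]; ring
    · have e1 := h.2.2.2 f
      have e2 := h'.2.2.2 f
      simp only [Prod.fst_add, Prod.snd_add, Pi.add_apply, mul_add, Finset.sum_add_distrib]
      rw [← e1, ← e2]; ring
  zero_mem' := by
    have := Fintype.ofFinite c.Edge
    exact ⟨0, 0, (isState_iff _ _ _ _ _).2 (by simp)⟩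
  smul_mem' := by
    have := Fintype.ofFinite c.Edge
    rintro r p ⟨φ, J, h⟩
    rw [isState_iff] at h
    refine ⟨r • φ, r • J, (isState_iff _ _ _ _ _).2 ⟨fun i => ?_, fun i => ?_, fun e => ?_,
      fun f => ?_⟩⟩
    · simp [h.1]
    · simp [h.2.1]
    · simp only [Pi.smul_apply, smul_eq_mul, mul_left_comm _ r, ← h.2.2.1]; ring
    · have e1 := h.2.2.2 f
      simp only [Prod.smul_fst, Prod.smul_snd, Pi.smul_apply, smul_eq_mul, mul_left_comm _ r,
        ← Finset.mul_sum]
      rw [← e1]; ring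

theorem mem_behavior {m n : ℕ} {c : Circuit k m n} {x : Fin m → k × k} {y : Fin n → k × k} :
    (x, y) ∈ behavior c ↔ ∃ φ J, IsState c x y φ J := Iff.rfl

theorem isLagrangianRelation_behavior {m n : ℕ} (c : Circuit k m n) :
    IsLagrangianRelation (behavior c) := by
  classical
  have := Fintype.ofFinite c.Edge
  have := Fintype.ofFinite c.Node
  rw [isLagrangianRelation_iff]
  intro x y
  simp only [mem_behavior, isState_iff]
  constructor
  · rintro ⟨φ, J, h1, h2, h3, h4⟩ x' y' ⟨φ', J', h1', h2', h3', h4'⟩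
    have e := h4 φ'
    have e' := h4' φ
    simp only [h1, h2, h3, h1', h2', h3'] at e e'
    simp only [sympForm_apply, Finset.sum_sub_distrib]
    rw [← e, ← e', add_sub_add_comm, ← Finset.sum_sub_distrib (f := fun e => c.label e * J e * J' e)]
    rw [left_eq_add]
    exact Finset.sum_eq_zero fun e _ => by ring
  · intro h
    let A : (c.Node → k) × (c.Edge → k) →ₗ[k] ((Fin m ⊕ Fin n) ⊕ (c.Edge ⊕ c.Node) → k) :=
      { toFun := fun u => Sum.elim (Sum.elim (fun i => u.1 (c.inp i)) fun j => u.1 (c.out j))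
          (Sum.elim (fun e => u.1 (c.tgt e) - u.1 (c.src e) - c.label e * u.2 e)
            (push c.tgt u.2 - push c.src u.2))
        map_add' := fun u v => by
          funext s
          rcases s with (s | s) | (s | s)
          · rfl
          · rfl
          · simp only [Prod.fst_add, Prod.snd_add, Pi.add_apply, Sum.elim_inr, Sum.elim_inl]; ring
          · simp only [Prod.fst_add, Prod.snd_add, Pi.add_apply, Sum.elim_inr, map_add,
              Pi.sub_apply]; ring
        map_smul' := fun r u => by
          funext s
          rcases s with (s | s) | (s | s)
          · rfl
          · rfl
          · simp only [Prod.smul_fst, Prod.smul_snd, Pi.smul_apply, Sum.elim_inr, Sum.elim_inl,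
              smul_eq_mul, RingHom.id_apply]; ring
          · simp only [Prod.smul_fst, Prod.smul_snd, Pi.smul_apply, Sum.elim_inr, map_smul,
              Pi.sub_apply, smul_eq_mul, RingHom.id_apply]; ring }
    obtain ⟨⟨φ, J⟩, hu⟩ := exists_solution A
      (Sum.elim (Sum.elim (fun i => (x i).1) fun j => (y j).1)
        (Sum.elim (fun _ => 0) (push c.out (fun j => (y j).2) - push c.inp fun i => (x i).2)))
      (by
        intro w hw
        simp only [Fintype.sum_sum_type, A, LinearMap.coe_mk, AddHom.coe_mk, Sum.elim_inl,
          Sum.elim_inr, Pi.sub_apply, mul_sub (w _) (push _ _ _), Finset.sum_sub_distrib (f := fun p => w _ * push _ _ p),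
          sum_mul_push c.tgt _ fun p => w (.inr (.inr p)),
          sum_mul_push c.src _ fun p => w (.inr (.inr p)),
          sum_mul_push c.out _ fun p => w (.inr (.inr p)),
          sum_mul_push c.inp _ fun p => w (.inr (.inr p))] at hw ⊢
        have key := h (fun i => (w (.inr (.inr (c.inp i))), w (.inl (.inl i))))
          (fun j => (w (.inr (.inr (c.out j))), -w (.inl (.inr j))))
          ⟨fun p => w (.inr (.inr p)), fun e => w (.inr (.inl e)), fun _ => rfl, fun _ => rfl,
            fun e => by
              have := hw (0, Pi.single e 1)
              simp [Pi.single_apply] at this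
              linear_combination this, fun f => by
              have := hw (f, 0)
              simp at this
              simp only [mul_comm (f _ - f _), mul_comm (f _), neg_mul, Finset.sum_neg_distrib]
              linear_combination this⟩
        simp only [sympForm_apply, Finset.sum_sub_distrib, mul_neg, Finset.sum_neg_distrib] at key
        simp only [mul_zero, Finset.sum_const_zero, mul_comm (w (.inl _))]
        linear_combination key)
    refine ⟨φ, J, fun i => congrFun hu (.inl (.inl i)), fun j => congrFun hu (.inl (.inr j)),
      fun e => sub_eq_zero.1 (congrFun hu (.inr (.inl e))), ?_⟩
    rw [← kirchhoff_iff]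
    intro p
    have := congrFun hu (.inr (.inr p))
    simp only [A, LinearMap.coe_mk, AddHom.coe_mk, Sum.elim_inr, Pi.sub_apply] at this
    simp only [finsum_fibre]
    linear_combination this

theorem behavior_le_of_iso {m n : ℕ} {a b : Circuit k m n} (f : Iso a b) :
    behavior a ≤ behavior b := by
  have := Fintype.ofFinite a.Edge
  have := Fintype.ofFinite b.Edge
  rintro ⟨x, y⟩ h
  obtain ⟨φ, J, h⟩ := mem_behavior.1 h
  obtain ⟨h1, h2, h3, h4⟩ := (isState_iff _ _ _ _ _).1 h
  refine ⟨fun p => φ (f.node.symm p), fun e => J (f.edge.symm e), (isState_iff _ _ _ _ _).2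
    ⟨fun i => ?_, fun j => ?_, fun e => ?_, fun g => ?_⟩⟩
  · rw [← f.inp, Equiv.symm_apply_apply]; exact h1 i
  · rw [← f.out, Equiv.symm_apply_apply]; exact h2 j
  · obtain ⟨e, rfl⟩ := f.edge.surjective e
    rw [← f.src, ← f.tgt, ← f.label]
    simp only [Equiv.symm_apply_apply]
    exact h3 e
  · rw [← f.edge.sum_comp]
    simp only [← f.inp, ← f.out, ← f.src, ← f.tgt, Equiv.symm_apply_apply]
    exact h4 fun p => g (f.node p)

theorem behavior_congr {m n : ℕ} {a b : Circuit k m n} (h : a ≈ b) : behavior a = behavior b := by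
  obtain ⟨g⟩ := Setoid.symm h
  obtain ⟨f⟩ := h
  exact le_antisymm (behavior_le_of_iso f) (behavior_le_of_iso g)

theorem isState_comp {l m n : ℕ} {a : Circuit k l m} {b : Circuit k m n} [Fintype a.Edge]
    [Fintype b.Edge] {x : Fin l → k × k} {z : Fin n → k × k} {φ : Quot (Glue a b) → k}
    {J : a.Edge ⊕ b.Edge → k} :
    IsState (comp a b) x z φ J ↔
      (∀ i, φ (Quot.mk _ (.inl (a.inp i))) = (x i).1) ∧
      (∀ j, φ (Quot.mk _ (.inr (b.out j))) = (z j).1) ∧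
      (∀ e, φ (Quot.mk _ (.inl (a.tgt e))) - φ (Quot.mk _ (.inl (a.src e))) =
        a.label e * J (.inl e)) ∧
      (∀ e, φ (Quot.mk _ (.inr (b.tgt e))) - φ (Quot.mk _ (.inr (b.src e))) =
        b.label e * J (.inr e)) ∧
      ∀ f : Quot (Glue a b) → k, ∑ i, f (Quot.mk _ (.inl (a.inp i))) * (x i).2 +
        (∑ e, (f (Quot.mk _ (.inl (a.tgt e))) - f (Quot.mk _ (.inl (a.src e)))) * J (.inl e) +
          ∑ e, (f (Quot.mk _ (.inr (b.tgt e))) - f (Quot.mk _ (.inr (b.src e)))) * J (.inr e)) =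
        ∑ j, f (Quot.mk _ (.inr (b.out j))) * (z j).2 := by
  let : Fintype (comp a b).Edge := inferInstanceAs (Fintype (a.Edge ⊕ b.Edge))
  have hs (g : a.Edge ⊕ b.Edge → k) : ∑ e : (comp a b).Edge, g e =
    ∑ e, g (.inl e) + ∑ e, g (.inr e) := Fintype.sum_sum_type g
  refine (isState_iff (comp a b) x z φ J).trans ?_
  constructor
  · rintro ⟨h1, h2, h3, h4⟩
    exact ⟨h1, h2, fun e => h3 (.inl e), fun e => h3 (.inr e), fun f =>
      (congrArg (_ + ·) (hs _).symm).trans (h4 f)⟩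
  · rintro ⟨h1, h2, h3, h3', h4⟩
    exact ⟨h1, h2, fun e => Sum.rec h3 h3' e, fun f => (congrArg (_ + ·) (hs _)).trans (h4 f)⟩

theorem behavior_comp {l m n : ℕ} (a : Circuit k l m) (b : Circuit k m n) :
    behavior (comp a b) = (behavior a).comp (behavior b) := by
  classical
  have := Fintype.ofFinite a.Edge
  have := Fintype.ofFinite b.Edge
  have := Fintype.ofFinite a.Node
  have := Fintype.ofFinite b.Node
  refine LinearRelation.ext' fun x z => ?_
  rw [LinearRelation.mem_comp]
  constructor
  · intro h
    obtain ⟨φ, J, h⟩ := mem_behavior.1 h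
    obtain ⟨h1, h2, h3, h3', h4⟩ := isState_comp.1 h
    let A : (Fin m → k) →ₗ[k] (a.Node ⊕ b.Node → k) :=
      { toFun := fun I => Sum.elim (push a.out I) (-push b.inp I)
        map_add' := fun I I' => by
          funext s
          rcases s with s | s
          · simp
          · simp; ring
        map_smul' := fun r I => by
          funext s
          rcases s with s | s <;> simp }
    obtain ⟨I, hI⟩ := exists_solution A
      (Sum.elim (push a.inp (fun i => (x i).2) + (push a.tgt (fun e => J (.inl e)) -
          push a.src fun e => J (.inl e)))
        (push b.tgt (fun e => J (.inr e)) - push b.src (fun e => J (.inr e)) -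
          push b.out fun j => (z j).2))
      (by
        intro c hc
        simp only [Fintype.sum_sum_type, A, LinearMap.coe_mk, AddHom.coe_mk, Sum.elim_inl,
          Sum.elim_inr, Pi.neg_apply, mul_neg, Finset.sum_neg_distrib,
          sum_mul_push a.out _ fun p => c (.inl p), sum_mul_push b.inp _ fun p => c (.inr p)] at hc
        have hc' : ∀ p q, Glue a b p q → c p = c q := by
          rintro _ _ ⟨y, rfl, rfl⟩
          have := hc (Pi.single y 1)
          simp only [Pi.single_apply, mul_ite, mul_one, mul_zero, Finset.sum_ite_eq',
            Finset.mem_univ, if_true] at this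
          linear_combination this
        have key := h4 (Quot.lift c hc')
        simp only [Fintype.sum_sum_type, Sum.elim_inl, Sum.elim_inr, Pi.add_apply, Pi.sub_apply,
          mul_add, mul_sub, Finset.sum_add_distrib, Finset.sum_sub_distrib,
          sum_mul_push a.inp _ fun p => c (.inl p), sum_mul_push a.tgt _ fun p => c (.inl p),
          sum_mul_push a.src _ fun p => c (.inl p), sum_mul_push b.tgt _ fun p => c (.inr p),
          sum_mul_push b.src _ fun p => c (.inr p), sum_mul_push b.out _ fun p => c (.inr p)]
        simp only [sub_mul, Finset.sum_sub_distrib] at key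
        linear_combination key)
    refine ⟨fun y => (φ (Quot.mk _ (.inl (a.out y))), I y),
      ⟨fun p => φ (Quot.mk _ (.inl p)), fun e => J (.inl e), h1, fun _ => rfl, h3, fun p => ?_⟩,
      ⟨fun p => φ (Quot.mk _ (.inr p)), fun e => J (.inr e),
        fun y => congrArg φ (Quot.sound ⟨y, rfl, rfl⟩).symm, h2, h3', fun p => ?_⟩⟩
    · have := congrFun hI (.inl p)
      simp only [A, LinearMap.coe_mk, AddHom.coe_mk, Sum.elim_inl, Pi.add_apply,
        Pi.sub_apply] at this
      simp only [finsum_fibre]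
      linear_combination -this
    · have := congrFun hI (.inr p)
      simp only [A, LinearMap.coe_mk, AddHom.coe_mk, Sum.elim_inr, Pi.neg_apply,
        Pi.sub_apply] at this
      simp only [finsum_fibre]
      linear_combination -this
  · rintro ⟨y, ⟨φ, J, h⟩, ⟨φ', J', h'⟩⟩
    obtain ⟨h1, h2, h3, h4⟩ := (isState_iff _ _ _ _ _).1 h
    obtain ⟨h1', h2', h3', h4'⟩ := (isState_iff _ _ _ _ _).1 h'
    refine ⟨Quot.lift (Sum.elim φ φ') ?_, Sum.elim J J', isState_comp.2
      ⟨h1, h2', h3, h3', fun f => ?_⟩⟩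
    · rintro _ _ ⟨y, rfl, rfl⟩
      exact (h2 y).trans (h1' y).symm
    · have e := h4 fun p => f (Quot.mk _ (.inl p))
      have e' := h4' fun p => f (Quot.mk _ (.inr p))
      have hf : ∀ y, f (Quot.mk _ (.inl (a.out y))) = f (Quot.mk _ (.inr (b.inp y))) :=
        fun y => congrArg f (Quot.sound ⟨y, rfl, rfl⟩)
      simp only [hf] at e
      simp only [Sum.elim_inl, Sum.elim_inr]
      linear_combination e + e'

theorem isState_tensor {m n m' n' : ℕ} {a : Circuit k m n} {b : Circuit k m' n'}
    {x : Fin (m + m') → k × k} {y : Fin (n + n') → k × k} {φ : a.Node ⊕ b.Node → k}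
    {J : a.Edge ⊕ b.Edge → k} :
    IsState (tensor a b) x y φ J ↔
      IsState a (fun i => x (Fin.castAdd m' i)) (fun j => y (Fin.castAdd n' j))
        (fun p => φ (.inl p)) (fun e => J (.inl e)) ∧
      IsState b (fun i => x (Fin.natAdd m i)) (fun j => y (Fin.natAdd n j))
        (fun p => φ (.inr p)) (fun e => J (.inr e)) := by
  have := Fintype.ofFinite a.Edge
  have := Fintype.ofFinite b.Edge
  let : Fintype (tensor a b).Edge := inferInstanceAs (Fintype (a.Edge ⊕ b.Edge))
  have hs (g : a.Edge ⊕ b.Edge → k) : ∑ e : (tensor a b).Edge, g e =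
    ∑ e, g (.inl e) + ∑ e, g (.inr e) := Fintype.sum_sum_type g
  have hE (f : a.Node ⊕ b.Node → k) : (∑ e : (tensor a b).Edge,
      (f ((tensor a b).tgt e) - f ((tensor a b).src e)) * J e) =
      ∑ e, (f (.inl (a.tgt e)) - f (.inl (a.src e))) * J (.inl e) +
      ∑ e, (f (.inr (b.tgt e)) - f (.inr (b.src e))) * J (.inr e) := hs _
  have hI (f : a.Node ⊕ b.Node → k) : ∑ i, f ((tensor a b).inp i) * (x i).2 =
      ∑ i, f (.inl (a.inp i)) * (x (Fin.castAdd m' i)).2 +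
      ∑ i, f (.inr (b.inp i)) * (x (Fin.natAdd m i)).2 := by
    simp only [Fin.sum_univ_add, tensor_inp_left, tensor_inp_right]
  have hO (f : a.Node ⊕ b.Node → k) : ∑ i, f ((tensor a b).out i) * (y i).2 =
      ∑ i, f (.inl (a.out i)) * (y (Fin.castAdd n' i)).2 +
      ∑ i, f (.inr (b.out i)) * (y (Fin.natAdd n i)).2 := by
    simp only [Fin.sum_univ_add, tensor_out_left, tensor_out_right]
  rw [isState_iff a, isState_iff b]
  refine (isState_iff (tensor a b) x y φ J).trans ?_
  constructor
  · rintro ⟨h1, h2, h3, h4⟩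
    refine ⟨⟨fun i => ?_, fun j => ?_, fun e => h3 (.inl e), fun f => ?_⟩,
      ⟨fun i => ?_, fun j => ?_, fun e => h3 (.inr e), fun f => ?_⟩⟩
    · rw [← h1, tensor_inp_left]
    · rw [← h2, tensor_out_left]
    · have := h4 (Sum.elim f 0)
      rw [hE, hI, hO] at this
      simpa using this
    · rw [← h1, tensor_inp_right]
    · rw [← h2, tensor_out_right]
    · have := h4 (Sum.elim 0 f)
      rw [hE, hI, hO] at this
      simpa using this
  · rintro ⟨⟨h1, h2, h3, h4⟩, ⟨h1', h2', h3', h4'⟩⟩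
    refine ⟨LinearRelation.forall_fin_add.2 ⟨fun i => ?_, fun i => ?_⟩,
      LinearRelation.forall_fin_add.2 ⟨fun i => ?_, fun i => ?_⟩, fun e => Sum.rec h3 h3' e,
      fun f => ?_⟩
    · rw [tensor_inp_left]; exact h1 i
    · rw [tensor_inp_right]; exact h1' i
    · rw [tensor_out_left]; exact h2 i
    · rw [tensor_out_right]; exact h2' i
    · refine (congrArg₂ (· + ·) (hI f) (hE f)).trans (Eq.trans ?_ (hO f).symm)
      linear_combination h4 (fun p => f (.inl p)) + h4' fun p => f (.inr p)

theorem behavior_tensor {m n m' n' : ℕ} (a : Circuit k m n) (b : Circuit k m' n') :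
    behavior (tensor a b) = (behavior a).tensor (behavior b) := by
  refine LinearRelation.ext' fun x y => ?_
  rw [LinearRelation.mem_tensor]
  constructor
  · rintro ⟨φ, J, h⟩
    have := isState_tensor.1 h
    exact ⟨⟨_, _, this.1⟩, ⟨_, _, this.2⟩⟩
  · rintro ⟨⟨φ, J, h⟩, ⟨φ', J', h'⟩⟩
    exact ⟨Sum.elim φ φ', Sum.elim J J', isState_tensor.2 ⟨h, h'⟩⟩

theorem mem_behavior_ofCospan {m n : ℕ} {N : Type} [Finite N] {i : Fin m → N} {o : Fin n → N}
    {x : Fin m → k × k} {y : Fin n → k × k} :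
    (x, y) ∈ behavior (ofCospan i o) ↔
      (∃ φ : N → k, (∀ s, φ (i s) = (x s).1) ∧ ∀ t, φ (o t) = (y t).1) ∧
      ∀ f : N → k, ∑ s, f (i s) * (x s).2 = ∑ t, f (o t) * (y t).2 := by
  let : Fintype (ofCospan (L := k) i o).Edge := inferInstanceAs (Fintype Empty)
  rw [mem_behavior]
  simp only [isState_iff]
  have hs (g : Empty → k) : ∑ e : (ofCospan (L := k) i o).Edge, g e = 0 := Fintype.sum_empty g
  constructor
  · rintro ⟨φ, J, h1, h2, h3, h4⟩
    refine ⟨⟨φ, h1, h2⟩, fun f => ?_⟩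
    exact ((add_zero _).symm.trans (congrArg (_ + ·) (hs _).symm)).trans (h4 f)
  · rintro ⟨⟨φ, h1, h2⟩, h4⟩
    exact ⟨φ, 0, h1, h2, fun e => e.elim, fun f =>
      ((congrArg (_ + ·) (hs _)).trans (add_zero _)).trans (h4 f)⟩

theorem mem_behavior_ofEquiv {m n : ℕ} (i : Fin m ≃ Fin n) {x : Fin m → k × k}
    {y : Fin n → k × k} :
    (x, y) ∈ behavior (ofCospan i fun t => t) ↔ ∀ s, y (i s) = x s := by
  classical
  rw [mem_behavior_ofCospan]
  constructor
  · rintro ⟨⟨φ, h1, h2⟩, h⟩ s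
    have := h (Pi.single (i s) 1)
    simp only [Pi.single_apply, i.injective.eq_iff, ite_mul, one_mul, zero_mul,
      Finset.sum_ite_eq', Finset.mem_univ, if_true] at this
    exact Prod.ext ((h2 _).symm.trans (h1 s)) this.symm
  · intro h
    refine ⟨⟨fun t => (y t).1, fun s => congrArg Prod.fst (h s), fun _ => rfl⟩, fun f => ?_⟩
    rw [← i.sum_comp]
    simp only [h]

theorem behavior_id (n : ℕ) : behavior (id k n) = LinearRelation.id k (k × k) n :=
  LinearRelation.ext' fun _ _ =>
    (mem_behavior_ofEquiv (Equiv.refl _)).trans (funext_iff.symm.trans eq_comm)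

theorem behavior_braid (m n : ℕ) : behavior (braid k m n) = LinearRelation.braid k (k × k) m n :=
  LinearRelation.ext' fun _ _ => (mem_behavior_ofEquiv (swapEquiv m n)).trans (by
    rw [LinearRelation.forall_fin_add, LinearRelation.mem_braid]
    simp only [swapEquiv, Equiv.coe_fn_mk, swap_castAdd, swap_natAdd])

end Circuit

variable (k) in
/-- The black box functor: it sends a linear circuit to its behaviour. -/
def blackBox : PropHom (Circ k) (LagRel k) where
  map := Quotient.lift (fun c => ⟨Circuit.behavior c, Circuit.isLagrangianRelation_behavior c⟩)
    fun _ _ h => Subtype.ext (Circuit.behavior_congr h)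
  map_id n := Subtype.ext (Circuit.behavior_id n)
  map_comp := by rintro _ _ _ ⟨a⟩ ⟨b⟩; exact Subtype.ext (Circuit.behavior_comp a b)
  map_tensor := by rintro _ _ _ _ ⟨a⟩ ⟨b⟩; exact Subtype.ext (Circuit.behavior_tensor a b)
  map_braid m n := Subtype.ext (Circuit.behavior_braid m n)

end BlackBoxing

section Diagrams

/-- The circuit made of perfectly conductive wires, all connected to a single node, for which a
generator stands. -/
def FrobSig.toCircuit {L : Type u} {m n : ℕ} (_ : FrobSig m n) : Circuit L m n :=
  Circuit.ofCospan (N := Unit) (fun _ => ()) fun _ => ()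

/-- The circuit with a single edge for which a label stands. -/
def LabelSig.toCircuit {L : Type u} : ∀ {m n : ℕ}, LabelSig L m n → Circuit L m n
  | _, _, .label l => Circuit.ofLabel l

/-- The morphism of props that sends a circuit diagram to the circuit that it depicts. -/
def circProjection (L : Type u) : PropHom (FreeCirc L) (Circ L) :=
  FreeProp.lift (Circ L) (Sum.elim (fun s => Quotient.mk _ s.toCircuit)
    fun s => Quotient.mk _ s.toCircuit)

variable {k : Type u} [Field k]

theorem mem_behavior_toCircuit {m n : ℕ} (s : FrobSig m n) {x : Fin m → k × k}
    {y : Fin n → k × k} :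
    (x, y) ∈ Circuit.behavior (s.toCircuit : Circuit k m n) ↔
      (∃ φ, (∀ i, (x i).1 = φ) ∧ ∀ j, (y j).1 = φ) ∧ ∑ i, (x i).2 = ∑ j, (y j).2 := by
  refine Circuit.mem_behavior_ofCospan.trans (and_congr ⟨?_, ?_⟩ ⟨fun h => ?_, fun h f => ?_⟩)
  · rintro ⟨φ, h, h'⟩
    exact ⟨φ (), fun i => (h i).symm, fun i => (h' i).symm⟩
  · rintro ⟨φ, h, h'⟩
    exact ⟨fun _ => φ, fun i => (h i).symm, fun i => (h' i).symm⟩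
  · simpa using h 1
  · rw [← Finset.mul_sum, ← Finset.mul_sum, h]

theorem mem_behavior_m {x : Fin 2 → k × k} {y : Fin 1 → k × k} :
    (x, y) ∈ Circuit.behavior (FrobSig.m.toCircuit : Circuit k 2 1) ↔
      (x 0).1 = (x 1).1 ∧ (x 1).1 = (y 0).1 ∧ (x 0).2 + (x 1).2 = (y 0).2 := by
  rw [mem_behavior_toCircuit]
  simp only [Fin.forall_fin_two, Fin.forall_fin_one, Fin.sum_univ_two, Fin.sum_univ_one]
  grind

theorem mem_behavior_i {x : Fin 0 → k × k} {y : Fin 1 → k × k} :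
    (x, y) ∈ Circuit.behavior (FrobSig.i.toCircuit : Circuit k 0 1) ↔ (y 0).2 = 0 := by
  rw [mem_behavior_toCircuit]
  simp [eq_comm]

theorem mem_behavior_d {x : Fin 1 → k × k} {y : Fin 2 → k × k} :
    (x, y) ∈ Circuit.behavior (FrobSig.d.toCircuit : Circuit k 1 2) ↔
      (x 0).1 = (y 0).1 ∧ (y 0).1 = (y 1).1 ∧ (x 0).2 = (y 0).2 + (y 1).2 := by
  rw [mem_behavior_toCircuit]
  simp only [Fin.forall_fin_two, Fin.forall_fin_one, Fin.sum_univ_two, Fin.sum_univ_one]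
  grind

theorem mem_behavior_e {x : Fin 1 → k × k} {y : Fin 0 → k × k} :
    (x, y) ∈ Circuit.behavior (FrobSig.e.toCircuit : Circuit k 1 0) ↔ (x 0).2 = 0 := by
  rw [mem_behavior_toCircuit]
  simp

theorem mem_behavior_label {z : k} {x y : Fin 1 → k × k} :
    (x, y) ∈ Circuit.behavior ((LabelSig.label z).toCircuit : Circuit k 1 1) ↔
      (y 0).1 - (x 0).1 = z * (x 0).2 ∧ (x 0).2 = (y 0).2 := by
  change (∃ φ J, Circuit.IsState (Circuit.ofLabel z) x y φ J) ↔ _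
  let : Fintype (Circuit.ofLabel z).Edge := inferInstanceAs (Fintype Unit)
  have hs (g : Unit → k) : ∑ e : (Circuit.ofLabel z).Edge, g e = g () := Fintype.sum_unique g
  constructor
  · rintro ⟨φ, J, h⟩
    obtain ⟨h1, h2, h3, h4⟩ := (Circuit.isState_iff _ _ _ _ _).1 h
    have key (f : Fin 2 → k) : f 0 * (x 0).2 + (f 1 - f 0) * J () = f 1 * (y 0).2 := by
      have := h4 f
      rw [Fin.sum_univ_one, Fin.sum_univ_one] at this
      exact (congrArg (_ + ·) (hs _).symm).trans this
    have k0 := key ![1, 0]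
    have k1 := key ![0, 1]
    simp at k0 k1
    have e1 : φ (0 : Fin 2) = (x 0).1 := h1 0
    have e2 : φ (1 : Fin 2) = (y 0).1 := h2 0
    have e3 : φ (1 : Fin 2) - φ (0 : Fin 2) = z * J () := h3 ()
    rw [← e1, ← e2, e3]
    exact ⟨by linear_combination -z * k0, by linear_combination k0 + k1⟩
  · rintro ⟨h, h'⟩
    refine ⟨![(x 0).1, (y 0).1], fun _ => (x 0).2, (Circuit.isState_iff _ _ _ _ _).2
      ⟨fun i => ?_, fun i => ?_, fun _ => h, fun f => ?_⟩⟩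
    · rw [Subsingleton.elim i 0]; rfl
    · rw [Subsingleton.elim i 0]; rfl
    · rw [Fin.sum_univ_one, Fin.sum_univ_one]
      refine (congrArg (_ + ·) (hs _)).trans ?_
      change f (0 : Fin 2) * _ + (f (1 : Fin 2) - f (0 : Fin 2)) * _ = f (1 : Fin 2) * _
      rw [h']; ring

/-- The graph of the linear map given by a matrix. -/
def LinearRelation.ofMatrix {m n : ℕ} (A : Matrix (Fin n) (Fin m) k) :
    LinearRelation k k m n where
  carrier := {p | p.2 = A.mulVec p.1}
  add_mem' {p q} hp hq := by
    simp only [Set.mem_ofPred_eq] at hp hq ⊢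
    simp [hp, hq, Matrix.mulVec_add]
  zero_mem' := by simp
  smul_mem' c p hp := by
    simp only [Set.mem_ofPred_eq] at hp ⊢
    simp [hp, Matrix.mulVec_smul]

/-- The relation obtained by exchanging source and target. -/
def LinearRelation.dagger {m n : ℕ} (R : LinearRelation k k m n) : LinearRelation k k n m where
  carrier := {p | (p.2, p.1) ∈ R}
  add_mem' {_ _} h h' := R.add_mem h h'
  zero_mem' := R.zero_mem
  smul_mem' c _ h := R.smul_mem c h

variable (k)

/-- Duplication: the graph of `x ↦ (x, x)`. -/
def duplication : LinearRelation k k 1 2 := .ofMatrix !![1; 1]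

/-- Deletion: the graph of the map from `k` to the zero space. -/
def deletion : LinearRelation k k 1 0 := .ofMatrix 0

/-- Addition: the graph of `(x, y) ↦ x + y`. -/
def addition : LinearRelation k k 2 1 := .ofMatrix !![1, 1]

/-- Zero: the graph of the map from the zero space to `k`. -/
def zero : LinearRelation k k 0 1 := .ofMatrix 0

variable {k}

/-- Multiplication by a scalar: the graph of `x ↦ c x`. -/
def scaling (c : k) : LinearRelation k k 1 1 := .ofMatrix !![c]

theorem mem_duplication {x : Fin 1 → k} {y : Fin 2 → k} :
    (x, y) ∈ duplication k ↔ y 0 = x 0 ∧ y 1 = x 0 := by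
  change y = _ ↔ _
  simp [funext_iff, Fin.forall_fin_two, dotProduct]

theorem mem_dagger_duplication {x : Fin 2 → k} {y : Fin 1 → k} :
    (x, y) ∈ (duplication k).dagger ↔ x 0 = y 0 ∧ x 1 = y 0 := mem_duplication

theorem mem_deletion {x : Fin 1 → k} {y : Fin 0 → k} : (x, y) ∈ deletion k :=
  Subsingleton.elim (α := Fin 0 → k) _ _

theorem mem_dagger_deletion {x : Fin 0 → k} {y : Fin 1 → k} : (x, y) ∈ (deletion k).dagger :=
  mem_deletion

theorem mem_addition {x : Fin 2 → k} {y : Fin 1 → k} :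
    (x, y) ∈ addition k ↔ y 0 = x 0 + x 1 := by
  change y = _ ↔ _
  simp [funext_iff, dotProduct]

theorem mem_dagger_addition {x : Fin 1 → k} {y : Fin 2 → k} :
    (x, y) ∈ (addition k).dagger ↔ x 0 = y 0 + y 1 := mem_addition

theorem mem_zero {x : Fin 0 → k} {y : Fin 1 → k} : (x, y) ∈ zero k ↔ y 0 = 0 := by
  change y = _ ↔ _
  simp [funext_iff]

theorem mem_dagger_zero {x : Fin 1 → k} {y : Fin 0 → k} :
    (x, y) ∈ (zero k).dagger ↔ x 0 = 0 := mem_zero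

theorem mem_scaling {c : k} {x y : Fin 1 → k} : (x, y) ∈ scaling c ↔ y 0 = c * x 0 := by
  change y = _ ↔ _
  simp [funext_iff, dotProduct]

/-- The prop of signal-flow diagrams, free on two copies of `FrobSig` and on the scalars.  The
first copy stands for coduplication, codeletion, duplication and deletion, the second copy for
addition, zero, coaddition and cozero. -/
def SigFlow (k : Type u) : PROP.{u} :=
  FreeProp (Signature.sum (Signature.sum FrobSig FrobSig) (LabelSig k))

/-- The meaning of the first four generators of signal-flow diagrams. -/
def FrobSig.duplicative : ∀ {m n : ℕ}, FrobSig m n → LinearRelation k k m n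
  | _, _, .m => (duplication k).dagger
  | _, _, .i => (deletion k).dagger
  | _, _, .d => duplication k
  | _, _, .e => deletion k

/-- The meaning of the next four generators of signal-flow diagrams. -/
def FrobSig.additive : ∀ {m n : ℕ}, FrobSig m n → LinearRelation k k m n
  | _, _, .m => addition k
  | _, _, .i => zero k
  | _, _, .d => (addition k).dagger
  | _, _, .e => (zero k).dagger

/-- The meaning of the scalars as signal-flow diagrams. -/
def LabelSig.scalar : ∀ {m n : ℕ}, LabelSig k m n → LinearRelation k k m n
  | _, _, .label c => scaling c

variable (k) in
/-- The morphism of props that sends a signal-flow diagram to the linear relation that it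
denotes. -/
def whiteBox : PropHom (SigFlow k) (FinRel k) :=
  FreeProp.lift (FinRel k) (Sum.elim (Sum.elim FrobSig.duplicative FrobSig.additive)
    LabelSig.scalar)

end Diagrams

end CircuitProps

namespace CircuitProps

/-! ### The subprop on the multiples of a number, and uniqueness of functors out of a free prop -/

section Multiples

/-! A circuit diagram is a word in generators subject to nothing but the laws of a prop. So a
functor out of the prop of circuit diagrams may be prescribed freely on generators, and two such
functors are equal once they agree on objects and on generators. Both sides of the square are
already known to be functors, so its commutativity is a comparison of two explicit linear relations
for each of `m`, `i`, `d`, `e` and each label.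

The translation replaces a wire by two wires, one for the potential and one for the current. At a
junction all potentials are equal and the currents are balanced. These are exactly the meanings of
the duplicative and of the additive generators: `m` becomes coduplication on potentials beside
addition on currents, `d` becomes duplication beside coaddition, `i` becomes codeletion beside zero,
and `e` becomes deletion beside cozero. Since the coordinates come as (potential, current) pairs,
`m` and `d` also need an exchange of the two middle wires. An edge with label `z` is the graph of
`(φ, I) ↦ (φ + z I, I)`: Ohm's law is solved for the outgoing potential, so no division by `z`
occurs and every field and every label is allowed.

One formal obstacle remains. `FreeProp.lift` yields only functors that are the identity on objects,
whereas the translation doubles objects. It is therefore built as a morphism of props into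
`PROP.multiple`, the full subprop on the even numbers renumbered by their halves, followed by the
inclusion of that subprop. The comparison on generators is `whiteBox_toSigFlow_frobSig` and
`whiteBox_toSigFlow_labelSig`; `FreeProp.strictFunctor_ext` extends it to all diagrams. -/

theorem castHom_id (P : PROP.{u}) {n n' : ℕ} (h : n = n') :
    castHom (H := P.Hom) h h (P.id n) = P.id n' := by
  subst h; rfl

/-- The objects `d * m + d * m'` and `d * (m + m')` are equal but are different expressions, so
transports appear throughout the subprop on multiples. This lemma and the two on `tensor` move a
transport outward past an operation. There `castHom_castHom` merges successive transports, and only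
their end objects matter, because any two proofs of the same equality agree. -/
theorem castHom_comp (P : PROP.{u}) {l m n l' m' n' : ℕ} (hl : l = l') (hm : m = m')
    (hn : n = n') (f : P.Hom l m) (g : P.Hom m n) :
    P.comp (castHom (H := P.Hom) hl hm f) (castHom (H := P.Hom) hm hn g) =
      castHom (H := P.Hom) hl hn (P.comp f g) := by
  subst hl hm hn; rfl

theorem castHom_tensor_left (P : PROP.{u}) {m n p q m' n' : ℕ} (hm : m = m') (hn : n = n')
    (f : P.Hom m n) (g : P.Hom p q) :
    P.tensor (castHom (H := P.Hom) hm hn f) g =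
      castHom (H := P.Hom) (congrArg (· + p) hm) (congrArg (· + q) hn) (P.tensor f g) := by
  subst hm hn; rfl

theorem castHom_tensor_right (P : PROP.{u}) {m n p q p' q' : ℕ} (hp : p = p') (hq : q = q')
    (f : P.Hom m n) (g : P.Hom p q) :
    P.tensor f (castHom (H := P.Hom) hp hq g) =
      castHom (H := P.Hom) (congrArg (m + ·) hp) (congrArg (n + ·) hq) (P.tensor f g) := by
  subst hp hq; rfl

/-- Needed in the hexagon law of the subprop, where a braiding past `d * (n + p)` has to be traded
for a braiding past `d * n + d * p`. -/
theorem castHom_braid (P : PROP.{u}) {m n m' n' : ℕ} (hm : m = m') (hn : n = n') :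
    castHom (H := P.Hom) (congrArg₂ (· + ·) hm hn) (congrArg₂ (· + ·) hn hm) (P.braid m n) =
      P.braid m' n' := by
  subst hm hn; rfl

/-- The laws of the subprop speak of transport in the family `H (g m) (g n)` along equalities
between the indices `m` and `n`. This turns it into transport in `H` itself, where the lemmas above
and the laws of the ambient prop apply. -/
theorem castHom_reindex {H : ℕ → ℕ → Type u} (g : ℕ → ℕ) {m m' n n' : ℕ} (hm : m = m')
    (hn : n = n') (f : H (g m) (g n)) :
    castHom (H := fun m n => H (g m) (g n)) hm hn f =
      castHom (H := H) (congrArg g hm) (congrArg g hn) f := by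
  subst hm hn; rfl

/-- The laws of props and of strict functors put a transport on one side only; this carries it to
the other side when the law has to be used as a rewriting rule or solved for the untransported term.
-/
theorem castHom_eq_iff {H : ℕ → ℕ → Type u} {m m' n n' : ℕ} (hm : m = m') (hn : n = n')
    {f : H m n} {g : H m' n'} :
    castHom hm hn f = g ↔ f = castHom hm.symm hn.symm g := by
  subst hm hn; rfl

/-- The full subprop of a prop on the multiples of `d`. -/
def PROP.multiple (P : PROP.{u}) (d : ℕ) : PROP.{u} where
  Hom m n := P.Hom (d * m) (d * n)
  id n := P.id (d * n)
  comp f g := P.comp f g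
  -- Identities and composition are literally those of `P`. Only the tensor product and the braiding
  -- need a transport, from a sum of multiples to the multiple of the sum.
  tensor {m n m' n'} f g := castHom (H := P.Hom) (Nat.mul_add d m m').symm
    (Nat.mul_add d n n').symm (P.tensor f g)
  braid m n := castHom (H := P.Hom) (Nat.mul_add d m n).symm (Nat.mul_add d n m).symm
    (P.braid (d * m) (d * n))
  id_comp f := P.id_comp f
  comp_id f := P.comp_id f
  assoc f g h := P.assoc f g h
  tensor_id m n := by rw [P.tensor_id, castHom_id]
  tensor_comp f g f' g' := by rw [P.tensor_comp, castHom_comp]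
  tensor_assoc f g h := by
    rw [castHom_reindex (H := P.Hom) (d * ·), castHom_tensor_left, castHom_tensor_right,
      ← P.tensor_assoc]
    simp only [castHom_castHom]
  id_zero_tensor {m n} f := by
    rw [castHom_reindex (H := P.Hom) (d * ·), castHom_castHom]
    -- `d * 0` reduces to `0`, so the unit of the subprop is the unit of `P` on the nose and the law
    -- of `P` applies.
    exact P.id_zero_tensor f
  tensor_id_zero {m n} f := by
    rw [castHom_reindex (H := P.Hom) (d * ·), castHom_castHom]
    exact P.tensor_id_zero f
  braid_natural f g := by rw [castHom_comp, castHom_comp, P.braid_natural]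
  braid_symm m n := by rw [castHom_comp, P.braid_symm, castHom_id]
  braid_zero n := by
    rw [castHom_reindex (H := P.Hom) (d * ·), castHom_castHom]
    exact P.braid_zero (d * n)
  hexagon m n p := by
    rw [castHom_reindex (H := P.Hom) (d * ·), castHom_reindex (H := P.Hom) (d * ·),
      castHom_tensor_left, castHom_tensor_right, castHom_castHom, castHom_castHom,
      castHom_castHom, castHom_castHom,
      -- Now the left side involves the braiding with `d * n + d * p`, the one about which the
      -- hexagon of `P` speaks.
      ← castHom_braid P rfl (Nat.mul_add d n p).symm, castHom_castHom]
    have h := P.hexagon (d * m) (d * n) (d * p)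
    rw [castHom_eq_iff] at h
    rw [h, castHom_castHom]
    have e : d * m + d * n + d * p = d * (m + n + p) := by ring
    have e' : d * n + (d * m + d * p) = d * (n + (m + p)) := by ring
    have e'' : d * n + (d * p + d * m) = d * (n + (p + m)) := by ring
    -- The transport of the first factor is split in two. Its inner half is the reassociation that
    -- occurs in the hexagon of `P`; its outer half ends at the same middle object as the transport
    -- of the second factor, so that `castHom_comp` can merge them.
    rw [← castHom_castHom (H := P.Hom) rfl (add_assoc (d * n) (d * m) (d * p)) e e']
    rw [castHom_comp P e e' _]

/-- The inclusion of the multiples of `d`; it sends the object `n` to the object `d * n`. -/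
def PROP.multipleInclusion (P : PROP.{u}) (d : ℕ) : StrictFunctor (P.multiple d) P where
  obj n := d * n
  map f := f
  obj_zero := rfl
  obj_add m n := Nat.mul_add d m n
  map_id _ := rfl
  map_comp _ _ := rfl
  -- The transport built into the tensor product of the subprop and the one in the functor law are
  -- mutually inverse; the same happens for the braiding.
  map_tensor _ _ := castHom_castHom _ _ _ _ _
  map_braid _ _ := castHom_castHom _ _ _ _ _

/-- Strict symmetric monoidal functors out of a free prop are equal if they agree on objects and
on generators. -/
theorem FreeProp.strictFunctor_ext {S : Signature.{u}} {Q : PROP.{v}}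
    {F G : StrictFunctor (FreeProp S) Q} (hobj : F.obj = G.obj)
    (hmap : ∀ {m n} (s : S m n), F.map (FreeProp.of s) ≍ G.map (FreeProp.of s)) : F = G := by
  obtain ⟨o, F, z, a, Fi, Fc, Ft, Fb⟩ := F
  obtain ⟨o', G, z', a', Gi, Gc, Gt, Gb⟩ := G
  -- Once the object maps are identified, the two maps on morphisms have the same type, and the
  -- heterogeneous equalities on generators become equalities.
  obtain rfl : o = o' := hobj
  -- Every morphism of the free prop is the class of a formal expression, so agreement spreads by
  -- induction on expressions. No relation between expressions has to be considered.
  have key : ∀ {m n} (f : Term S m n),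
      F (Quot.mk Term.Rel f : (FreeProp S).Hom m n) = G (Quot.mk Term.Rel f) := by
    intro m n f
    induction f with
    | gen s => exact eq_of_heq (hmap s)
    | id n => exact (Fi n).trans (Gi n).symm
    | comp f g ihf ihg =>
      exact (Fc (Quot.mk _ f) (Quot.mk _ g)).trans
        ((congrArg₂ Q.comp ihf ihg).trans (Gc (Quot.mk _ f) (Quot.mk _ g)).symm)
    | tensor f g ihf ihg =>
      have h := (Ft (Quot.mk _ f) (Quot.mk _ g)).trans
        ((congrArg₂ Q.tensor ihf ihg).trans (Gt (Quot.mk _ f) (Quot.mk _ g)).symm)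
      -- Both functor laws carry a transport between the same objects, so the two transports cancel
      -- and the untransported images are equal.
      rw [castHom_eq_iff, castHom_castHom] at h
      exact h
    | braid m n =>
      have h := (Fb m n).trans (Gb m n).symm
      rw [castHom_eq_iff, castHom_castHom] at h
      exact h
  have : @F = @G := by
    funext m n f
    exact Quot.ind (β := fun f : (FreeProp S).Hom m n => F f = G f) key f
  -- The remaining fields of the two structures are proofs, hence equal.
  subst this
  rfl

end Multiples

/-! ### The translation of circuit diagrams and its correctness on generators -/

section CircuitsToSignalFlow

variable {k : Type u} [Field k]

/-- The morphism `4 ⟶ 4` that exchanges the two wires in the middle. -/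
def PROP.middleSwap (P : PROP.{u}) : P.Hom 4 4 :=
  P.tensor (P.tensor (P.id 1) (P.braid 1 1)) (P.id 1)

/-- A generator among coduplication, codeletion, duplication and deletion. -/
def SigFlow.duplicative {m n : ℕ} (s : FrobSig m n) : (SigFlow k).Hom m n :=
  FreeProp.of (Sum.inl (Sum.inl s))

/-- A generator among addition, zero, coaddition and cozero. -/
def SigFlow.additive {m n : ℕ} (s : FrobSig m n) : (SigFlow k).Hom m n :=
  FreeProp.of (Sum.inl (Sum.inr s))

/-- Scalar multiplication, as a signal-flow diagram. -/
def SigFlow.scalar (c : k) : (SigFlow k).Hom 1 1 :=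
  FreeProp.of (Sum.inr (.label c))

/-- The signal-flow diagram on potentials and currents for a junction of wires. -/
def FrobSig.toSigFlow : ∀ {m n : ℕ}, FrobSig m n → (SigFlow k).Hom (2 * m) (2 * n)
  -- The inputs arrive as `φ₁, I₁, φ₂, I₂`. The exchange gathers them into `φ₁, φ₂, I₁, I₂`; then
  -- the potentials are forced to agree and the currents are added.
  | _, _, .m => (SigFlow k).comp (l := 4) (m := 4) (n := 2) (SigFlow k).middleSwap
      ((SigFlow k).tensor (SigFlow.duplicative .m) (SigFlow.additive .m))
  -- At a dead end the potential is arbitrary and the current vanishes. With a single pair of wires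
  -- there is nothing to rearrange.
  | _, _, .i => (SigFlow k).tensor (SigFlow.duplicative .i) (SigFlow.additive .i)
  -- The mirror image of `m`: the exchange comes last and restores the interleaved order of the
  -- outputs.
  | _, _, .d => (SigFlow k).comp (l := 2) (m := 4) (n := 4)
      ((SigFlow k).tensor (SigFlow.duplicative .d) (SigFlow.additive .d)) (SigFlow k).middleSwap
  | _, _, .e => (SigFlow k).tensor (SigFlow.duplicative .e) (SigFlow.additive .e)

/-- The signal-flow diagram on potentials and currents for an edge of a circuit, which adds the
label times the current to the potential. -/
def LabelSig.toSigFlow : ∀ {m n : ℕ}, LabelSig k m n → (SigFlow k).Hom (2 * m) (2 * n)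
  -- The stages are `(φ, I) ↦ (φ, I, I) ↦ (φ, z I, I) ↦ (φ + z I, I)`; the current is copied because
  -- it is needed both for the voltage and as output.
  | _, _, .label z => (SigFlow k).comp (l := 2) (m := 3) (n := 2)
      ((SigFlow k).tensor ((SigFlow k).id 1) (SigFlow.duplicative .d))
      ((SigFlow k).comp (l := 3) (m := 3) (n := 2)
        ((SigFlow k).tensor
          ((SigFlow k).tensor ((SigFlow k).id 1) (SigFlow.scalar z)) ((SigFlow k).id 1))
        ((SigFlow k).tensor (SigFlow.additive .m) ((SigFlow k).id 1)))

variable (k) in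
/-- The functor from circuit diagrams to signal-flow diagrams that replaces each wire by a pair of
wires, which carry its potential and its current. -/
def circToSigFlow : StrictFunctor (FreeCirc k) (SigFlow k) :=
  (FreeProp.lift ((SigFlow k).multiple 2)
    (Sum.elim FrobSig.toSigFlow LabelSig.toSigFlow)).toStrictFunctor.comp
      ((SigFlow k).multipleInclusion 2)

/-- The meaning of the exchange of the two wires in the middle, as a linear relation. -/
def LinearRelation.middleSwap (k : Type u) [Field k] : LinearRelation k k 4 4 :=
  (FinRel k).middleSwap

/-- The exchange is built from identities, a braiding and tensor products alone. Hence `whiteBox`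
sends the one in `SigFlow` to the one in `FinRel` by mere computation, and this description in
coordinates serves for both `m` and `d`. -/
theorem mem_middleSwap {x y : Fin 4 → k} :
    (x, y) ∈ LinearRelation.middleSwap k ↔
      y 0 = x 0 ∧ y 1 = x 2 ∧ y 2 = x 1 ∧ y 3 = x 3 := by
  have e1 (f g : Fin 1 → k) : f = g ↔ f 0 = g 0 := by
    rw [funext_iff, Fin.forall_fin_one]
  refine (and_congr (and_congr (e1 _ _) (and_congr Fin.forall_fin_one Fin.forall_fin_one))
    (e1 _ _)).trans ?_
  -- All arities are numerals, so the indices produced by the nested tensor products evaluate to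
  -- concrete elements of `Fin 4`.
  change ((x 0 = y 0 ∧ y 2 = x 1 ∧ y 1 = x 2) ∧ x 3 = y 3) ↔ _
  grind

/-- Kirchhoff's current law at the single node of the circuit is the additive half of the diagram,
and the common potential of that node is the duplicative half. It remains to eliminate the
intermediate vectors of the composites. -/
theorem whiteBox_toSigFlow_frobSig {m n : ℕ} (s : FrobSig m n) :
    (whiteBox k).map s.toSigFlow = flattenRelation (Circuit.behavior s.toCircuit) := by
  refine LinearRelation.ext' fun x y => ?_
  rw [mem_flattenRelation]
  cases s with
  | m =>
    refine Iff.trans ?_ mem_behavior_m.symm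
    -- Both sides unfold by computation. Under `pairUp` the even coordinates are the potentials and
    -- the odd ones the currents.
    change (∃ z : Fin 4 → k, (x, z) ∈ LinearRelation.middleSwap k ∧
      (z, y) ∈ (LinearRelation.tensor (duplication k).dagger (addition k) :
        LinearRelation k k (2 + 2) (1 + 1))) ↔
      x (0 : Fin 4) = x (2 : Fin 4) ∧ x (2 : Fin 4) = y (0 : Fin 2) ∧
        x (1 : Fin 4) + x (3 : Fin 4) = y (1 : Fin 2)
    refine (exists_congr fun z => and_congr mem_middleSwap
      (and_congr mem_dagger_duplication mem_addition)).trans ?_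
    constructor
    · rintro ⟨z, ⟨h0, h1, h2, h3⟩, ⟨h4, h5⟩, h6⟩
      exact ⟨h0.symm.trans (h4.trans (h5.symm.trans h1)), h1.symm.trans h5,
        (congrArg₂ (· + ·) h2 h3).symm.trans h6.symm⟩
    · rintro ⟨h0, h1, h2⟩
      -- The intermediate vector is forced: it is `x` with its potentials placed before its
      -- currents.
      exact ⟨![x (0 : Fin 4), x (2 : Fin 4), x (1 : Fin 4), x (3 : Fin 4)],
        ⟨rfl, rfl, rfl, rfl⟩, ⟨h0.trans h1, h1⟩, h2.symm⟩
  | i =>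
    refine Iff.trans ?_ mem_behavior_i.symm
    -- Codeletion imposes no condition on the potential, so only the vanishing of the current is
    -- left.
    exact (and_congr (iff_of_true mem_dagger_deletion trivial) mem_zero).trans (Iff.of_eq (true_and _))
  | d =>
    refine Iff.trans ?_ mem_behavior_d.symm
    change (∃ z : Fin 4 → k, (x, z) ∈ (LinearRelation.tensor (duplication k) (addition k).dagger :
        LinearRelation k k (1 + 1) (2 + 2)) ∧ (z, y) ∈ LinearRelation.middleSwap k) ↔
      x (0 : Fin 2) = y (0 : Fin 4) ∧ y (0 : Fin 4) = y (2 : Fin 4) ∧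
        x (1 : Fin 2) = y (1 : Fin 4) + y (3 : Fin 4)
    refine (exists_congr fun z => and_congr (and_congr mem_duplication mem_dagger_addition)
      mem_middleSwap).trans ?_
    constructor
    · rintro ⟨z, ⟨⟨h4, h5⟩, h6⟩, h0, h1, h2, h3⟩
      exact ⟨h4.symm.trans h0.symm, h0.trans (h4.trans (h5.symm.trans h2.symm)),
        h6.trans (congrArg₂ (· + ·) h1 h3).symm⟩
    · rintro ⟨h0, h1, h2⟩
      -- The exchange is its own inverse, so the intermediate vector is recovered from the output
      -- `y` by the same permutation.
      exact ⟨![y (0 : Fin 4), y (2 : Fin 4), y (1 : Fin 4), y (3 : Fin 4)],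
        ⟨⟨h0.symm, (h0.trans h1).symm⟩, h2⟩, rfl, rfl, rfl, rfl⟩
  | e =>
    refine Iff.trans ?_ mem_behavior_e.symm
    exact (and_congr (iff_of_true mem_deletion trivial) mem_dagger_zero).trans (Iff.of_eq (true_and _))

/-- With a single edge between input and output, Kirchhoff's law makes the two currents equal, and
Ohm's law gives the output potential as a function of the input. The behaviour is thus the graph of
the linear map that the three stages of the diagram compute. -/
theorem whiteBox_toSigFlow_labelSig {m n : ℕ} (s : LabelSig k m n) :
    (whiteBox k).map s.toSigFlow = flattenRelation (Circuit.behavior s.toCircuit) := by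
  refine LinearRelation.ext' fun x y => ?_
  rw [mem_flattenRelation]
  obtain ⟨z⟩ := s
  refine Iff.trans ?_ mem_behavior_label.symm
  -- Here `u` is the vector after the current is copied and `v` the one after one copy is scaled by
  -- `z`.
  change (∃ u : Fin 3 → k,
      (x, u) ∈ ((LinearRelation.id k k 1).tensor (duplication k) :
        LinearRelation k k (1 + 1) (1 + 2)) ∧
      ∃ v : Fin 3 → k,
        (u, v) ∈ (((LinearRelation.id k k 1).tensor (scaling z)).tensor (LinearRelation.id k k 1) :
          LinearRelation k k (1 + 1 + 1) (1 + 1 + 1)) ∧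
        (v, y) ∈ ((addition k).tensor (LinearRelation.id k k 1) :
          LinearRelation k k (2 + 1) (1 + 1))) ↔
    y (0 : Fin 2) - x (0 : Fin 2) = z * x (1 : Fin 2) ∧ x (1 : Fin 2) = y (1 : Fin 2)
  refine (exists_congr fun u => and_congr (and_congr LinearRelation.mem_id mem_duplication)
    (exists_congr fun v => and_congr
      (and_congr (and_congr LinearRelation.mem_id mem_scaling) LinearRelation.mem_id)
      (and_congr mem_addition LinearRelation.mem_id))).trans ?_
  constructor
  · rintro ⟨u, ⟨h0, h1, h2⟩, v, ⟨⟨h3, h4⟩, h5⟩, h6, h7⟩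
    -- Membership in an identity relation on one wire is an equality of functions on `Fin 1`; its
    -- value at `0` is the scalar equation that is wanted.
    replace h0 : x (0 : Fin 2) = u 0 := congrFun h0 0
    replace h3 : u 0 = v 0 := congrFun h3 0
    replace h5 : u 2 = v 2 := congrFun h5 0
    replace h7 : v 2 = y (1 : Fin 2) := congrFun h7 0
    change u 1 = x (1 : Fin 2) at h1
    change u 2 = x (1 : Fin 2) at h2
    change v 1 = z * u 1 at h4
    change y (0 : Fin 2) = v 0 + v 1 at h6
    refine ⟨?_, h2.symm.trans (h5.trans h7)⟩
    rw [h6, h4, h1, h0, h3, add_sub_cancel_left]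
  · rintro ⟨h, h'⟩
    -- The intermediate vectors are `(φ, I, I)` and `(φ, z I, I)`. The open goals are the conditions
    -- on the wires that pass through unchanged.
    refine ⟨![x (0 : Fin 2), x (1 : Fin 2), x (1 : Fin 2)], ⟨?_, rfl, rfl⟩,
      ![x (0 : Fin 2), z * x (1 : Fin 2), x (1 : Fin 2)], ⟨⟨?_, rfl⟩, ?_⟩,
      eq_add_of_sub_eq' h, ?_⟩
    all_goals
      funext i
      rw [Subsingleton.elim i 0]
    · rfl
    · rfl
    · rfl
    · exact h'

end CircuitsToSignalFlow

end CircuitProps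

/-! ### The commuting square -/

theorem mainTheorem6 (k : Type u) [Field k] :
    ∃ T : CircuitProps.StrictFunctor (CircuitProps.FreeCirc k) (CircuitProps.SigFlow k),
      T.obj 1 = 2 ∧
      T.comp (CircuitProps.whiteBox k).toStrictFunctor =
        ((CircuitProps.circProjection k).toStrictFunctor.comp
          (CircuitProps.blackBox k).toStrictFunctor).comp (CircuitProps.LagRel.inclusion k) := by
  -- Both ways around the square send `n` to `2 * n` by definition, so the object maps agree by
  -- `rfl` and the heterogeneous equalities on generators are ordinary ones.
  refine ⟨CircuitProps.circToSigFlow k, rfl, CircuitProps.FreeProp.strictFunctor_ext rfl ?_⟩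
  rintro m n (s | s)
  · exact heq_of_eq (CircuitProps.whiteBox_toSigFlow_frobSig s)
  · exact heq_of_eq (CircuitProps.whiteBox_toSigFlow_labelSig s)
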